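/- Let $k$ be an algebraically closed field of characteristic $0$ and let $p$ be a prime number. A \emph{biproduct} $A = B \times H$ of a Hopf algebra $H$ and a Hopf algebra $B$ in the category ${}_H^H\mathcal{YD}$ of left-left Yetter--Drinfel'd modules is the Hopf algebra with underlying vector space $B \otimes H$, the smash product $(b \times h)(b' \times h') = b(h_{(1)}\cdot b') \times h_{(2)}h'$ and the smash coproduct $\Delta(b \times h) = (b_{(1)} \times b_{(2)(-1)}h_{(1)}) \otimes (b_{(2)(0)} \times h_{(2)})$. Let $\pi : A \to H$, $\pi(b\times h) = \epsilon(b)h$, and let $\mathrm{Aut}_{\mathrm{Hopf}}(A,\pi)$ be the group of Hopf algebra automorphisms $F$ of $A$ with $\pi \circ F = \pi$. For such $F$ define $F_L : B \to B$ and $F_R : H \to B$ by $F_L(b) = (\mathrm{Id}_B \otimes \epsilon)(F(b \times 1))$ and $F_R(h) = (\mathrm{Id}_B \otimes \epsilon)(F(1 \times h))$; the map $\nu(F) = F_L$ is a group homomorphism $\mathrm{Aut}_{\mathrm{Hopf}}(A,\pi) \to \mathrm{Aut}_{\mathrm{Alg}}(B)$. Let $\mathcal{N}(B,H)$ be the group,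 under convolution, of all $F_R$ with $F \in \mathrm{Aut}_{\mathrm{Hopf}}(A,\pi)$ and $F_L = \mathrm{Id}_B$, and let $\mathrm{Aut}_{\mathcal{YD}\text{-}\mathrm{Hopf}}(B)$ be the group of automorphisms of $B$ as an algebra, coalgebra, left $H$-module and left $H$-comodule. With $\varphi(f)(g) = f \circ g$, there is an injective group homomorphism $$\Phi_{\mathcal{YD}} : \mathcal{N}(B,H)^{op} \rtimes_\varphi \mathrm{Aut}_{\mathcal{YD}\text{-}\mathrm{Hopf}}(B) \to \mathrm{Aut}_{\mathrm{Hopf}}(A,\pi)$$ and, when $H$ is cocommutative, an injective group homomorphism $$\Phi_\nu : \mathcal{N}(B,H)^{op} \rtimes_\varphi \mathrm{Im}(\nu) \to \mathrm{Sym}(A),$$ both given by $(g,f) \mapsto \bigl(b \times h \mapsto f(b)g(h_{(1)}) \times h_{(2)}\bigr)$. \textbf{Proposition.} There exist a finite abelian group $\mathcal{G}$ and a biproduct $A = k[\mathcal{G}] \times k[\mathbb{Z}_p]$ (where $B = k[\mathcal{G}]$ and $H = k[\mathbb{Z}_p]$ carry their usual group algebra and coalgebra structures) such that: (a) The injective group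 homomorphism $\Phi_{\mathcal{YD}}$ is not surjective. In particular there is an $F \in \mathrm{Aut}_{\mathrm{Hopf}}(A,\pi)$ such that $F_L$ is not a coalgebra map. (b) The injective group homomorphism $\Phi_\nu$ satisfies $\mathrm{Im}(\Phi_\nu) \not\subseteq \mathrm{Aut}_{\mathrm{Hopf}}(A,\pi)$. -/

import Mathlib

open scoped TensorProduct
open Coalgebra (comul counit)

noncomputable section

universe u v w

/-- `B` (an algebra and a coalgebra over `k`) as a Hopf algebra in the category of left-left
Yetter-Drinfel'd modules over the Hopf algebra `H`: the module structure `act h b = h · b`, the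
comodule structure `coact b = b₍₋₁₎ ⊗ b₍₀₎`, and all the compatibilities. These are exactly the
data for which the biproduct `B × H` is defined. -/
structure YDHopf (k : Type u) (H : Type v) (B : Type w) [Field k] [Ring H] [HopfAlgebra k H]
    [Ring B] [Algebra k B] [Coalgebra k B] where
  /-- the left `H`-module structure, `h ⊗ b ↦ h · b` -/
  act : H ⊗[k] B →ₗ[k] B
  /-- the left `H`-comodule structure, `b ↦ b₍₋₁₎ ⊗ b₍₀₎` -/
  coact : B →ₗ[k] H ⊗[k] B
  one_act : ∀ b : B, act (1 ⊗ₜ b) = b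
  mul_act : ∀ (h h' : H) (b : B), act ((h * h') ⊗ₜ b) = act (h ⊗ₜ act (h' ⊗ₜ b))
  coact_coassoc : ∀ b : B,
    TensorProduct.assoc k H H B ((comul (R := k) (A := H)).rTensor B (coact b)) =
      coact.lTensor H (coact b)
  coact_counit : ∀ b : B, TensorProduct.lid k B ((counit (R := k) (A := H)).rTensor B (coact b)) = b
  /-- module algebra: `h · 1 = ε(h) 1` -/
  act_one : ∀ h : H, act (h ⊗ₜ 1) = algebraMap k B (counit h)
  /-- module algebra: `h · (b b') = (h₍₁₎ · b) (h₍₂₎ · b')` -/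
  act_mul : ∀ (h : H) (b b' : B), act (h ⊗ₜ (b * b')) =
    LinearMap.mul' k B (TensorProduct.map act act
      (TensorProduct.tensorTensorTensorComm k H H B B (comul h ⊗ₜ (b ⊗ₜ b'))))
  /-- comodule algebra: `ρ(1) = 1 ⊗ 1` -/
  coact_one : coact 1 = 1 ⊗ₜ 1
  /-- comodule algebra: `ρ(b b') = b₍₋₁₎ b'₍₋₁₎ ⊗ b₍₀₎ b'₍₀₎` -/
  coact_mul : ∀ b b' : B, coact (b * b') = coact b * coact b'
  /-- module coalgebra: `ε(h · b) = ε(h) ε(b)` -/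
  counit_act : ∀ (h : H) (b : B), counit (R := k) (act (h ⊗ₜ b)) = counit h * counit b
  /-- module coalgebra: `Δ(h · b) = h₍₁₎ · b₍₁₎ ⊗ h₍₂₎ · b₍₂₎` -/
  comul_act : ∀ (h : H) (b : B), comul (R := k) (act (h ⊗ₜ b)) =
    TensorProduct.map act act
      (TensorProduct.tensorTensorTensorComm k H H B B (comul h ⊗ₜ comul b))
  /-- comodule coalgebra: `b₍₋₁₎ ε(b₍₀₎) = ε(b) 1` -/
  coact_counit' : ∀ b : B,
    TensorProduct.rid k H ((counit (R := k) (A := B)).lTensor H (coact b)) =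
      algebraMap k H (counit b)
  /-- comodule coalgebra:
  `b₍₁₎₍₋₁₎ b₍₂₎₍₋₁₎ ⊗ (b₍₁₎₍₀₎ ⊗ b₍₂₎₍₀₎) = b₍₋₁₎ ⊗ (b₍₀₎₍₁₎ ⊗ b₍₀₎₍₂₎)` -/
  coact_comul : ∀ b : B,
    (LinearMap.mul' k H).rTensor (B ⊗[k] B)
      (TensorProduct.tensorTensorTensorComm k H B H B
        (TensorProduct.map coact coact (comul b))) =
      (comul (R := k) (A := B)).lTensor H (coact b)
  counit_one : counit (R := k) (1 : B) = 1
  counit_mul : ∀ b b' : B, counit (R := k) (b * b') = counit b * counit b'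
  comul_one : comul (R := k) (1 : B) = 1 ⊗ₜ 1
  /-- `Δ(b b') = b₍₁₎ (b₍₂₎₍₋₁₎ · b'₍₁₎) ⊗ b₍₂₎₍₀₎ b'₍₂₎` -/
  comul_mul : ∀ b b' : B, comul (R := k) (b * b') =
    (LinearMap.mul' k B).rTensor B
      ((TensorProduct.assoc k B B B).symm
        ((TensorProduct.map act (LinearMap.mul' k B)).lTensor B
          ((TensorProduct.tensorTensorTensorComm k H B B B).toLinearMap.lTensor B
            (TensorProduct.assoc k B (H ⊗[k] B) (B ⊗[k] B)
              (coact.lTensor B (comul b) ⊗ₜ comul b')))))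
  /-- the Yetter-Drinfel'd condition
  `h₍₁₎ b₍₋₁₎ ⊗ h₍₂₎ · b₍₀₎ = (h₍₁₎ · b)₍₋₁₎ h₍₂₎ ⊗ (h₍₁₎ · b)₍₀₎` -/
  yd : ∀ (h : H) (b : B),
    TensorProduct.map (LinearMap.mul' k H) act
      (TensorProduct.tensorTensorTensorComm k H H H B (comul h ⊗ₜ coact b)) =
    (LinearMap.mul' k H).rTensor B
      ((TensorProduct.assoc k H H B).symm
        ((TensorProduct.comm k B H).toLinearMap.lTensor H
          (TensorProduct.assoc k H B H
            ((coact ∘ₗ act).rTensor H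
              ((TensorProduct.comm k H (H ⊗[k] B))
                (TensorProduct.assoc k H H B
                  (TensorProduct.comm k H H (comul h) ⊗ₜ b)))))))
  /-- `Id_B` is invertible for the convolution product -/
  antipode : IsUnit (WithConv.toConv (LinearMap.id : B →ₗ[k] B))

namespace YDHopf

section Phi

variable {k : Type u} {H : Type v} {B : Type w} [Field k] [Ring H] [HopfAlgebra k H]
  [Ring B] [Algebra k B]

/-- The linear endomorphism `b ⊗ h ↦ f(b) g(h₍₁₎) ⊗ h₍₂₎` of `B ⊗ H`. -/
def phiLin (f : B →ₗ[k] B) (g : WithConv (H →ₗ[k] B)) : B ⊗[k] H →ₗ[k] B ⊗[k] H :=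
  (LinearMap.mul' k B).rTensor H ∘ₗ
  (TensorProduct.assoc k B B H).symm.toLinearMap ∘ₗ
  TensorProduct.map f (g.ofConv.rTensor H ∘ₗ comul)

lemma phiLin_tmul (f : B →ₗ[k] B) (g : WithConv (H →ₗ[k] B)) (b : B) (h : H) :
    phiLin f g (b ⊗ₜ h) = (LinearMap.mulLeft k (f b) ∘ₗ g.ofConv).rTensor H (comul h) := by
  simp only [phiLin, LinearMap.comp_apply, TensorProduct.map_tmul, LinearEquiv.coe_coe]
  induction (comul (R := k) h) using TensorProduct.induction_on with
  | zero => simp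
  | tmul x y => simp
  | add x y hx hy => simp only [map_add, TensorProduct.tmul_add, hx, hy]

/-- The monoid endomorphism `g ↦ f ∘ g` of the convolution algebra `Hom(H, B)`. -/
def compConv (f : B ≃ₐ[k] B) : WithConv (H →ₗ[k] B) →* WithConv (H →ₗ[k] B) where
  toFun g := WithConv.toConv (f.toLinearMap ∘ₗ g.ofConv)
  map_one' := by ext h; simp
  map_mul' g g' := congrArg WithConv.toConv
    (LinearMap.algHom_comp_convMul_distrib (f : B →ₐ[k] B) g g')

/-- The action `f ▷ g = f ∘ g` of `Aut_Alg(B)` on the group `U(H, B)` of units of the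
convolution algebra `Hom(H, B)`. -/
def actUnits (f : B ≃ₐ[k] B) :
    (WithConv (H →ₗ[k] B))ˣ →* (WithConv (H →ₗ[k] B))ˣ := Units.map (compConv f)

lemma actUnits_mul (f f' : B ≃ₐ[k] B) (u : (WithConv (H →ₗ[k] B))ˣ) :
    actUnits (f * f') u = actUnits f (actUnits f' u) := rfl

lemma actUnits_one (u : (WithConv (H →ₗ[k] B))ˣ) : actUnits 1 u = u := rfl

lemma actUnits_inv (f : B ≃ₐ[k] B) (u : (WithConv (H →ₗ[k] B))ˣ) :
    actUnits f (actUnits f⁻¹ u) = u := by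
  rw [← actUnits_mul, mul_inv_cancel, actUnits_one]

lemma phiLin_comp (f f' : B ≃ₐ[k] B) (g g' : WithConv (H →ₗ[k] B)) :
    phiLin f.toLinearMap g ∘ₗ phiLin f'.toLinearMap g' =
      phiLin (f * f').toLinearMap (compConv f g' * g) := by
  refine TensorProduct.ext' fun b h => ?_
  rw [LinearMap.comp_apply, phiLin_tmul, phiLin_tmul]
  set T : H ⊗[k] (H ⊗[k] H) →ₗ[k] B ⊗[k] H :=
    (LinearMap.mulLeft k (f (f' b)) ∘ₗ LinearMap.mul' k B ∘ₗ
      TensorProduct.map (f.toLinearMap ∘ₗ g'.ofConv) g.ofConv).rTensor H ∘ₗ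
      (TensorProduct.assoc k H H H).symm.toLinearMap with hT
  have h1 : ∀ t : H ⊗[k] H, phiLin f.toLinearMap g
      ((LinearMap.mulLeft k (f'.toLinearMap b) ∘ₗ g'.ofConv).rTensor H t) =
      T ((comul (R := k) (A := H)).lTensor H t) := by
    intro t
    induction t using TensorProduct.induction_on with
    | zero => simp
    | add x y hx hy => simp only [map_add, hx, hy]
    | tmul x y =>
      simp only [LinearMap.rTensor_tmul, LinearMap.lTensor_tmul, phiLin_tmul]
      induction (comul (R := k) y) using TensorProduct.induction_on with
      | zero => simp
      | add x y hx hy => simp only [map_add, TensorProduct.tmul_add, hx, hy]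
      | tmul y z => simp [hT]
  have h2 : ∀ t : H ⊗[k] H,
      (LinearMap.mulLeft k ((f * f').toLinearMap b) ∘ₗ (compConv f g' * g).ofConv).rTensor H t =
      T (TensorProduct.assoc k H H H ((comul (R := k) (A := H)).rTensor H t)) := by
    intro t
    induction t using TensorProduct.induction_on with
    | zero => simp
    | add x y hx hy => simp only [map_add, hx, hy]
    | tmul x y => simp [hT, compConv]
  rw [h1, h2, Coalgebra.coassoc_apply]

lemma phiLin_one : phiLin (1 : B ≃ₐ[k] B).toLinearMap (1 : WithConv (H →ₗ[k] B)) =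
    LinearMap.id := by
  refine TensorProduct.ext' fun b h => ?_
  have key : ∀ t : H ⊗[k] H,
      (LinearMap.mulLeft k b ∘ₗ (1 : WithConv (H →ₗ[k] B)).ofConv).rTensor H t =
      (LinearMap.toSpanSingleton k B b).rTensor H
        ((counit (R := k) (A := H)).rTensor H t) := by
    intro t
    induction t using TensorProduct.induction_on with
    | zero => simp
    | add x y hx hy => simp only [map_add, hx, hy]
    | tmul x y => simp [Algebra.smul_def, Algebra.commutes]
  rw [phiLin_tmul]
  refine (key _).trans ?_
  rw [Coalgebra.rTensor_counit_comul]
  simp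

/-- For `f` in `Aut_Alg(B)` and a convolution invertible `g : H → B`, the linear automorphism
`b ⊗ h ↦ f(b) g(h₍₁₎) ⊗ h₍₂₎` of `B ⊗ H`. -/
def phi (f : B ≃ₐ[k] B) (u : (WithConv (H →ₗ[k] B))ˣ) : (B ⊗[k] H) ≃ₗ[k] (B ⊗[k] H) :=
  LinearEquiv.ofLinearMap (phiLin f.toLinearMap u.val)
    (phiLin (f⁻¹).toLinearMap (actUnits f⁻¹ u⁻¹).val)
    (by
      rw [phiLin_comp, mul_inv_cancel, ← phiLin_one]
      congr 1
      exact congrArg Units.val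
        (show actUnits f (actUnits f⁻¹ u⁻¹) * u = 1 by rw [actUnits_inv, inv_mul_cancel]))
    (by
      rw [phiLin_comp, inv_mul_cancel, ← phiLin_one]
      congr 1
      exact congrArg Units.val
        (show actUnits f⁻¹ u * actUnits f⁻¹ u⁻¹ = 1 by rw [← map_mul, mul_inv_cancel, map_one]))

lemma phi_mul (f f' : B ≃ₐ[k] B) (u u' : (WithConv (H →ₗ[k] B))ˣ) :
    phi f u * phi f' u' = phi (f * f') (actUnits f u' * u) :=
  LinearEquiv.toLinearMap_injective (phiLin_comp f f' u.val u'.val)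

lemma phi_one : phi (1 : B ≃ₐ[k] B) (1 : (WithConv (H →ₗ[k] B))ˣ) = 1 :=
  LinearEquiv.toLinearMap_injective phiLin_one

/-- The action `φ(f)(g) = f ∘ g` of a subgroup `K` of `Aut_Alg(B)` on `N^op`, for a subgroup `N`
of `U(H, B)` which is stable under `K`. -/
def semiAct (K : Subgroup (B ≃ₐ[k] B)) (N : Subgroup (WithConv (H →ₗ[k] B))ˣ)
    (hKN : ∀ f ∈ K, ∀ u ∈ N, actUnits f u ∈ N) : K →* MulAut (N)ᵐᵒᵖ where
  toFun f :=
    { toFun := fun u => MulOpposite.op ⟨actUnits f.1 u.unop.1, hKN _ f.2 _ u.unop.2⟩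
      invFun := fun u =>
        MulOpposite.op ⟨actUnits f.1⁻¹ u.unop.1, hKN _ (inv_mem f.2) _ u.unop.2⟩
      left_inv := fun u => MulOpposite.unop_injective (Subtype.ext (by
        change actUnits f.1⁻¹ (actUnits f.1 u.unop.1) = _
        rw [← actUnits_mul, inv_mul_cancel, actUnits_one]))
      right_inv := fun u => MulOpposite.unop_injective (Subtype.ext (actUnits_inv _ _))
      map_mul' := fun u v => MulOpposite.unop_injective (Subtype.ext
        (map_mul (actUnits f.1) v.unop.1 u.unop.1)) }
  map_one' := rfl
  map_mul' _ _ := rfl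

/-- The group homomorphism `N^op ⋊_φ K → GL(B ⊗ H)`,
`(g, f) ↦ (b ⊗ h ↦ f(b) g(h₍₁₎) ⊗ h₍₂₎)`. -/
def phiHom (K : Subgroup (B ≃ₐ[k] B)) (N : Subgroup (WithConv (H →ₗ[k] B))ˣ)
    (hKN : ∀ f ∈ K, ∀ u ∈ N, actUnits f u ∈ N) :
    (N)ᵐᵒᵖ ⋊[semiAct K N hKN] K →* ((B ⊗[k] H) ≃ₗ[k] (B ⊗[k] H)) where
  toFun x := phi x.right.1 x.left.unop.1
  map_one' := phi_one
  map_mul' _ _ := (phi_mul _ _ _ _).symm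

lemma phi_one_toLinearMap (f : B ≃ₐ[k] B) :
    (phi f (1 : (WithConv (H →ₗ[k] B))ˣ)).toLinearMap = f.toLinearMap.rTensor H := by
  change phiLin f.toLinearMap (1 : WithConv (H →ₗ[k] B)) = _
  have h := congrArg (fun x => f.toLinearMap.rTensor H ∘ₗ x) (phiLin_one (k := k) (H := H) (B := B))
  simp only [LinearMap.comp_id] at h
  rw [← h]
  refine TensorProduct.ext' fun b x => ?_
  rw [LinearMap.comp_apply, phiLin_tmul, phiLin_tmul]
  generalize comul (R := k) x = t
  induction t using TensorProduct.induction_on with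
  | zero => simp
  | add x y hx hy => simp only [map_add, hx, hy]
  | tmul x y => simp

end Phi

variable {k : Type u} {H : Type v} {B : Type w} [Field k] [Ring H] [HopfAlgebra k H]
  [Ring B] [Algebra k B] [Coalgebra k B]

/-- The multiplication of the biproduct `B × H`, whose underlying vector space is `B ⊗ H`:
`(b ⊗ h)(b' ⊗ h') = b (h₍₁₎ · b') ⊗ h₍₂₎ h'` (smash product). -/
def mul (D : YDHopf k H B) : (B ⊗[k] H) ⊗[k] (B ⊗[k] H) →ₗ[k] B ⊗[k] H :=
  (LinearMap.mul' k B).rTensor H ∘ₗ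
  (TensorProduct.assoc k B B H).symm.toLinearMap ∘ₗ
  (TensorProduct.map D.act (LinearMap.mul' k H) ∘ₗ
    (TensorProduct.tensorTensorTensorComm k H H B H).toLinearMap ∘ₗ
    (comul (R := k) (A := H)).rTensor (B ⊗[k] H)).lTensor B ∘ₗ
  (TensorProduct.assoc k B H (B ⊗[k] H)).toLinearMap

/-- The comultiplication of the biproduct `B × H`:
`Δ(b ⊗ h) = (b₍₁₎ ⊗ b₍₂₎₍₋₁₎ h₍₁₎) ⊗ (b₍₂₎₍₀₎ ⊗ h₍₂₎)` (smash coproduct). -/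
def comult (D : YDHopf k H B) : B ⊗[k] H →ₗ[k] (B ⊗[k] H) ⊗[k] (B ⊗[k] H) :=
  (TensorProduct.assoc k B H (B ⊗[k] H)).symm.toLinearMap ∘ₗ
  ((LinearMap.mul' k H).rTensor (B ⊗[k] H) ∘ₗ
    (TensorProduct.tensorTensorTensorComm k H B H H).toLinearMap).lTensor B ∘ₗ
  (TensorProduct.assoc k B (H ⊗[k] B) (H ⊗[k] H)).toLinearMap ∘ₗ
  TensorProduct.map (D.coact.lTensor B ∘ₗ comul) comul

/-- The counit `ε(b ⊗ h) = ε(b) ε(h)` of the biproduct. -/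
def counitA (_ : YDHopf k H B) : B ⊗[k] H →ₗ[k] k :=
  LinearMap.mul' k k ∘ₗ TensorProduct.map counit counit

/-- The projection `π : B × H → H`, `b ⊗ h ↦ ε(b) h`. -/
def proj (_ : YDHopf k H B) : B ⊗[k] H →ₗ[k] H :=
  (TensorProduct.lid k H).toLinearMap ∘ₗ (counit (R := k) (A := B)).rTensor H

/-- The map `Π : B × H → B`, `b ⊗ h ↦ b ε(h)`. -/
def projB (_ : YDHopf k H B) : B ⊗[k] H →ₗ[k] B :=
  (TensorProduct.rid k B).toLinearMap ∘ₗ (counit (R := k) (A := H)).lTensor B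

/-- The map `j : H → B × H`, `h ↦ 1 ⊗ h`. -/
def incl (_ : YDHopf k H B) : H →ₗ[k] B ⊗[k] H := TensorProduct.mk k B H 1

/-- The map `J : B → B × H`, `b ↦ b ⊗ 1`. -/
def inclB (_ : YDHopf k H B) : B →ₗ[k] B ⊗[k] H := (TensorProduct.mk k B H).flip 1

/-- The group `Aut_Hopf(A)` of Hopf algebra automorphisms of the biproduct `A = B × H`. -/
def autHopf (D : YDHopf k H B) : Subgroup ((B ⊗[k] H) ≃ₗ[k] (B ⊗[k] H)) where
  carrier := {F | (∀ x y, F (D.mul (x ⊗ₜ y)) = D.mul (F x ⊗ₜ F y)) ∧ F (1 ⊗ₜ 1) = 1 ⊗ₜ 1 ∧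
    (∀ x, D.comult (F x) = TensorProduct.map F.toLinearMap F.toLinearMap (D.comult x)) ∧
    ∀ x, D.counitA (F x) = D.counitA x}
  one_mem' := ⟨fun _ _ => rfl, rfl, fun x => by
    simp, fun _ => rfl⟩
  mul_mem' := by
    rintro F G ⟨h1, h2, h3, h4⟩ ⟨g1, g2, g3, g4⟩
    refine ⟨fun x y => ?_, ?_, fun x => ?_, fun x => ?_⟩
    · simp [LinearEquiv.mul_apply, g1, h1]
    · simp [LinearEquiv.mul_apply, g2, h2]
    · have : ((F * G : (B ⊗[k] H) ≃ₗ[k] (B ⊗[k] H)) : (B ⊗[k] H) →ₗ[k] (B ⊗[k] H)) =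
        F.toLinearMap ∘ₗ G.toLinearMap := rfl
      rw [this, TensorProduct.map_comp, LinearEquiv.mul_apply, h3, g3]; rfl
    · simp [LinearEquiv.mul_apply, g4, h4]
  inv_mem' := by
    rintro F ⟨h1, h2, h3, h4⟩
    have e : ∀ x, F (F⁻¹ x) = x := F.apply_symm_apply
    refine ⟨fun x y => F.injective ?_, F.injective ?_, fun x => ?_, fun x => ?_⟩
    · rw [h1, e, e, e]
    · rw [h2, e]
    · have h := h3 (F⁻¹ x)
      rw [e] at h
      rw [h, ← LinearMap.comp_apply, ← TensorProduct.map_comp]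
      have : (F⁻¹).toLinearMap ∘ₗ F.toLinearMap = LinearMap.id := by
        exact LinearMap.ext fun y => F.symm_apply_apply y
      rw [this]; simp
    · rw [← h4, e]

/-- The group `Aut_Hopf(A, π)` of Hopf algebra automorphisms `F` of `A = B × H`
with `π ∘ F = π`. -/
def autHopfProj (D : YDHopf k H B) : Subgroup ((B ⊗[k] H) ≃ₗ[k] (B ⊗[k] H)) where
  carrier := {F | F ∈ D.autHopf ∧ ∀ x, D.proj (F x) = D.proj x}
  one_mem' := ⟨one_mem _, fun _ => rfl⟩
  mul_mem' := by
    rintro F G ⟨h1, h2⟩ ⟨g1, g2⟩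
    exact ⟨mul_mem h1 g1, fun x => by rw [LinearEquiv.mul_apply, h2, g2]⟩
  inv_mem' := by
    rintro F ⟨h1, h2⟩
    exact ⟨inv_mem h1, fun x => by rw [← h2]; congr 1; exact F.apply_symm_apply x⟩

/-- `F_L = Π ∘ F ∘ J : B → B`. -/
def left (D : YDHopf k H B) (F : (B ⊗[k] H) ≃ₗ[k] (B ⊗[k] H)) : B →ₗ[k] B :=
  D.projB ∘ₗ F.toLinearMap ∘ₗ D.inclB

/-- `F_R = Π ∘ F ∘ j : H → B`, as an element of the convolution algebra `Hom(H, B)`. -/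
def right (D : YDHopf k H B) (F : (B ⊗[k] H) ≃ₗ[k] (B ⊗[k] H)) : WithConv (H →ₗ[k] B) :=
  WithConv.toConv (D.projB ∘ₗ F.toLinearMap ∘ₗ D.incl)

/-- The group `Aut_{YD-Hopf}(B)`: algebra automorphisms of `B` which are also maps of
coalgebras, of left `H`-modules and of left `H`-comodules. -/
def autYD (D : YDHopf k H B) : Subgroup (B ≃ₐ[k] B) where
  carrier := {f | (∀ b, counit (R := k) (f b) = counit (R := k) b) ∧
    (∀ b, comul (R := k) (f b) = TensorProduct.map f.toLinearMap f.toLinearMap (comul b)) ∧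
    (∀ h b, f (D.act (h ⊗ₜ b)) = D.act (h ⊗ₜ f b)) ∧
    ∀ b, D.coact (f b) = f.toLinearMap.lTensor H (D.coact b)}
  one_mem' := by
    have : ((1 : B ≃ₐ[k] B)).toLinearMap = LinearMap.id := rfl
    exact ⟨fun _ => rfl, fun b => by simp [this], fun _ _ => rfl, fun b => by simp [this]⟩
  mul_mem' := by
    rintro F G ⟨h1, h2, h3, h4⟩ ⟨g1, g2, g3, g4⟩
    have : (F * G : B ≃ₐ[k] B).toLinearMap = F.toLinearMap ∘ₗ G.toLinearMap := rfl
    refine ⟨fun b => ?_, fun b => ?_, fun h b => ?_, fun b => ?_⟩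
    · rw [AlgEquiv.mul_apply, h1, g1]
    · rw [this, TensorProduct.map_comp, AlgEquiv.mul_apply, h2, g2]; rfl
    · simp only [AlgEquiv.mul_apply, g3, h3]
    · rw [this, LinearMap.lTensor_comp, AlgEquiv.mul_apply, h4, g4]; rfl
  inv_mem' := by
    rintro F ⟨h1, h2, h3, h4⟩
    have e : ∀ x, F (F⁻¹ x) = x := F.apply_symm_apply
    have e' : (F⁻¹).toLinearMap ∘ₗ F.toLinearMap = LinearMap.id := by
      exact LinearMap.ext fun y => F.symm_apply_apply y
    refine ⟨fun x => ?_, fun x => ?_, fun h x => F.injective ?_, fun x => ?_⟩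
    · rw [← h1, e]
    · have h := h2 (F⁻¹ x)
      rw [e] at h
      rw [h, ← LinearMap.comp_apply, ← TensorProduct.map_comp, e']; simp
    · rw [h3, e, e]
    · have h := h4 (F⁻¹ x)
      rw [e] at h
      rw [h, ← LinearMap.comp_apply, ← LinearMap.lTensor_comp, e']; simp

lemma mul_tmul (D : YDHopf k H B) (b b' : B) (h h' : H) :
    D.mul ((b ⊗ₜ h) ⊗ₜ (b' ⊗ₜ h')) =
      TensorProduct.map (LinearMap.mulLeft k b ∘ₗ D.act ∘ₗ (TensorProduct.mk k H B).flip b')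
        (LinearMap.mulRight k h') (comul h) := by
  simp only [mul, LinearMap.comp_apply, LinearEquiv.coe_coe, TensorProduct.assoc_tmul,
    LinearMap.lTensor_tmul, LinearMap.rTensor_tmul]
  induction (comul (R := k) h) using TensorProduct.induction_on with
  | zero => simp
  | add x y hx hy => simp only [map_add, TensorProduct.add_tmul, TensorProduct.tmul_add, hx, hy]
  | tmul x y => simp

lemma mul_tmul_one (D : YDHopf k H B) (b b' : B) (h' : H) :
    D.mul ((b ⊗ₜ 1) ⊗ₜ (b' ⊗ₜ h')) = (b * b') ⊗ₜ h' := by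
  simp [mul_tmul, Bialgebra.comul_one, Algebra.TensorProduct.one_def, D.one_act]

lemma projB_tmul (D : YDHopf k H B) (b : B) (h : H) :
    D.projB (b ⊗ₜ h) = counit (R := k) h • b := by simp [projB]

lemma projB_mul (D : YDHopf k H B) (b : B) (y : B ⊗[k] H) :
    D.projB (D.mul ((b ⊗ₜ 1) ⊗ₜ y)) = b * D.projB y := by
  induction y using TensorProduct.induction_on with
  | zero => simp
  | add x y hx hy => simp only [map_add, TensorProduct.tmul_add, hx, hy, mul_add]
  | tmul b' h => simp [mul_tmul_one, projB_tmul]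

/-- The map `b ⊗ h ↦ (b ⊗ h₍₁₎) ⊗ h₍₂₎`. -/
def coactA (_ : YDHopf k H B) : B ⊗[k] H →ₗ[k] (B ⊗[k] H) ⊗[k] H :=
  (TensorProduct.assoc k B H H).symm.toLinearMap ∘ₗ (comul (R := k) (A := H)).lTensor B

set_option synthInstance.maxHeartbeats 200000 in
lemma proj_comult (D : YDHopf k H B) (x : B ⊗[k] H) :
    D.proj.lTensor (B ⊗[k] H) (D.comult x) = D.coactA x := by
  induction x using TensorProduct.induction_on with
  | zero => simp
  | add x y hx hy => simp only [map_add, hx, hy]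
  | tmul b h =>
    have key : ∀ (r : B ⊗[k] B) (t : H ⊗[k] H),
        D.proj.lTensor (B ⊗[k] H) ((TensorProduct.assoc k B H (B ⊗[k] H)).symm
          (((LinearMap.mul' k H).rTensor (B ⊗[k] H) ∘ₗ
            (TensorProduct.tensorTensorTensorComm k H B H H).toLinearMap).lTensor B
          (TensorProduct.assoc k B (H ⊗[k] B) (H ⊗[k] H) (D.coact.lTensor B r ⊗ₜ t)))) =
        (TensorProduct.assoc k B H H).symm
          (TensorProduct.rid k B ((counit (R := k) (A := B)).lTensor B r) ⊗ₜ t) := by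
      intro r t
      induction r using TensorProduct.induction_on with
      | zero => simp
      | add x y hx hy => simp only [map_add, TensorProduct.add_tmul, hx, hy]
      | tmul c d =>
        induction t using TensorProduct.induction_on with
        | zero => simp
        | add x y hx hy => simp only [map_add, TensorProduct.tmul_add, hx, hy]
        | tmul x y =>
          have h1 : ∀ s : H ⊗[k] B,
              D.proj.lTensor (B ⊗[k] H) ((TensorProduct.assoc k B H (B ⊗[k] H)).symm
                (c ⊗ₜ (LinearMap.mul' k H).rTensor (B ⊗[k] H)
                  (TensorProduct.tensorTensorTensorComm k H B H H (s ⊗ₜ (x ⊗ₜ y))))) =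
              (c ⊗ₜ (TensorProduct.rid k H ((counit (R := k) (A := B)).lTensor H s) * x)) ⊗ₜ y := by
            intro s
            induction s using TensorProduct.induction_on with
            | zero => simp
            | add x y hx hy =>
              simp only [map_add, TensorProduct.add_tmul, TensorProduct.tmul_add, hx, hy, add_mul]
            | tmul g e => simp [proj, TensorProduct.tmul_smul, TensorProduct.smul_tmul']
          have h2 := h1 (D.coact d)
          rw [D.coact_counit'] at h2
          simpa [Algebra.algebraMap_eq_smul_one, TensorProduct.smul_tmul',
            TensorProduct.tmul_smul] using h2
    have := key (comul b) (comul h)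
    rw [Coalgebra.lTensor_counit_comul] at this
    simpa [comult, coactA] using this

lemma projB_coactA (D : YDHopf k H B) (x : B ⊗[k] H) :
    D.projB.rTensor H (D.coactA x) = x := by
  induction x using TensorProduct.induction_on with
  | zero => simp
  | add x y hx hy => simp only [map_add, hx, hy]
  | tmul b h =>
    have key : ∀ t : H ⊗[k] H, D.projB.rTensor H ((TensorProduct.assoc k B H H).symm (b ⊗ₜ t)) =
        b ⊗ₜ TensorProduct.lid k H ((counit (R := k) (A := H)).rTensor H t) := by
      intro t
      induction t using TensorProduct.induction_on with
      | zero => simp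
      | add x y hx hy => simp only [map_add, TensorProduct.tmul_add, hx, hy]
      | tmul x y => simp [projB_tmul, TensorProduct.tmul_smul, TensorProduct.smul_tmul']
    have := key (comul h)
    rw [Coalgebra.rTensor_counit_comul] at this
    simpa [coactA] using this

lemma apply_eq (D : YDHopf k H B) {F : (B ⊗[k] H) ≃ₗ[k] (B ⊗[k] H)} (hF : F ∈ D.autHopfProj)
    (x : B ⊗[k] H) : F x = (D.projB ∘ₗ F.toLinearMap).rTensor H (D.coactA x) := by
  have hp : D.proj ∘ₗ F.toLinearMap = D.proj := LinearMap.ext hF.2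
  have h1 : D.coactA (F x) = F.toLinearMap.rTensor H (D.coactA x) := by
    rw [← proj_comult, hF.1.2.2.1, ← proj_comult]
    generalize D.comult x = t
    induction t using TensorProduct.induction_on with
    | zero => simp
    | add x y hx hy => simp only [map_add, hx, hy]
    | tmul x y => simp [hF.2 y]
  rw [LinearMap.rTensor_comp, LinearMap.comp_apply, ← h1, projB_coactA]

lemma apply_tmul_one (D : YDHopf k H B) {F : (B ⊗[k] H) ≃ₗ[k] (B ⊗[k] H)}
    (hF : F ∈ D.autHopfProj) (b : B) : F (b ⊗ₜ 1) = D.left F b ⊗ₜ 1 := by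
  rw [apply_eq D hF]
  simp [coactA, Bialgebra.comul_one, Algebra.TensorProduct.one_def, left, inclB]

lemma projB_apply (D : YDHopf k H B) {F : (B ⊗[k] H) ≃ₗ[k] (B ⊗[k] H)}
    (hF : F ∈ D.autHopfProj) (b : B) (h : H) :
    D.projB (F (b ⊗ₜ h)) = D.left F b * (D.right F).ofConv h := by
  have h1 := hF.1.1 (b ⊗ₜ 1) (1 ⊗ₜ h)
  rw [mul_tmul_one, mul_one, apply_tmul_one D hF] at h1
  rw [h1, projB_mul]
  rfl

lemma eq_phiLin (D : YDHopf k H B) {F : (B ⊗[k] H) ≃ₗ[k] (B ⊗[k] H)}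
    (hF : F ∈ D.autHopfProj) : F.toLinearMap = phiLin (D.left F) (D.right F) := by
  refine TensorProduct.ext' fun b h => ?_
  rw [phiLin_tmul, LinearEquiv.coe_coe, apply_eq D hF]
  simp only [coactA, LinearMap.comp_apply, LinearMap.lTensor_tmul, LinearEquiv.coe_coe]
  induction (comul (R := k) h) using TensorProduct.induction_on with
  | zero => simp
  | add x y hx hy => simp only [map_add, TensorProduct.tmul_add, hx, hy]
  | tmul x y => simp [projB_apply D hF]

lemma tmul_one_injective (D : YDHopf k H B) {b b' : B}
    (h : b ⊗ₜ[k] (1 : H) = b' ⊗ₜ[k] (1 : H)) : b = b' := by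
  simpa [projB_tmul] using congrArg D.projB h

lemma left_map_mul (D : YDHopf k H B) {F : (B ⊗[k] H) ≃ₗ[k] (B ⊗[k] H)}
    (hF : F ∈ D.autHopfProj) (b b' : B) : D.left F (b * b') = D.left F b * D.left F b' := by
  apply D.tmul_one_injective
  rw [← apply_tmul_one D hF, ← mul_tmul_one D, hF.1.1, apply_tmul_one D hF, apply_tmul_one D hF,
    mul_tmul_one]

lemma left_map_one (D : YDHopf k H B) {F : (B ⊗[k] H) ≃ₗ[k] (B ⊗[k] H)}
    (hF : F ∈ D.autHopfProj) : D.left F 1 = 1 := by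
  apply D.tmul_one_injective
  rw [← apply_tmul_one D hF, hF.1.2.1]

lemma left_mul_apply (D : YDHopf k H B) {F G : (B ⊗[k] H) ≃ₗ[k] (B ⊗[k] H)}
    (hF : F ∈ D.autHopfProj) (hG : G ∈ D.autHopfProj) (b : B) :
    D.left (F * G) b = D.left F (D.left G b) := by
  apply D.tmul_one_injective
  rw [← apply_tmul_one D (mul_mem hF hG), LinearEquiv.mul_apply, apply_tmul_one D hG,
    apply_tmul_one D hF]

lemma left_one_apply (D : YDHopf k H B) (b : B) :
    D.left (1 : (B ⊗[k] H) ≃ₗ[k] (B ⊗[k] H)) b = b := by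
  apply D.tmul_one_injective
  rw [← apply_tmul_one D (one_mem _)]
  rfl

/-- The group homomorphism `ν : Aut_Hopf(A, π) → Aut_Alg(B)`, `ν(F) = F_L`. -/
def nu (D : YDHopf k H B) : D.autHopfProj →* (B ≃ₐ[k] B) where
  toFun F := AlgEquiv.ofLinearEquiv
    { D.left F.1 with
      invFun := D.left F.1⁻¹
      left_inv := fun b => by
        change D.left F.1⁻¹ (D.left F.1 b) = b
        rw [← left_mul_apply D (inv_mem F.2) F.2, inv_mul_cancel, left_one_apply]
      right_inv := fun b => by
        change D.left F.1 (D.left F.1⁻¹ b) = b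
        rw [← left_mul_apply D F.2 (inv_mem F.2), mul_inv_cancel, left_one_apply] }
    (left_map_one D F.2) (left_map_mul D F.2)
  map_one' := AlgEquiv.ext (left_one_apply D)
  map_mul' F G := AlgEquiv.ext (left_mul_apply D F.2 G.2)

lemma projB_phiLin (D : YDHopf k H B) (f : B →ₗ[k] B) (g : WithConv (H →ₗ[k] B)) (b : B) (h : H) :
    D.projB (phiLin f g (b ⊗ₜ h)) = f b * g.ofConv h := by
  have key : ∀ t : H ⊗[k] H,
      D.projB ((LinearMap.mulLeft k (f b) ∘ₗ g.ofConv).rTensor H t) =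
      f b * g.ofConv (TensorProduct.rid k H ((counit (R := k) (A := H)).lTensor H t)) := by
    intro t
    induction t using TensorProduct.induction_on with
    | zero => simp
    | add x y hx hy => simp only [map_add, hx, hy, mul_add]
    | tmul x y => simp [projB_tmul]
  rw [phiLin_tmul, key, Coalgebra.lTensor_counit_comul]
  simp

lemma right_mul (D : YDHopf k H B) (F G : D.autHopfProj) :
    D.right (F * G).1 = compConv (D.nu F) (D.right G.1) * D.right F.1 := by
  have h : (F * G).1.toLinearMap = phiLin (D.nu F * D.nu G).toLinearMap
      (compConv (D.nu F) (D.right G.1) * D.right F.1) := by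
    rw [← phiLin_comp]
    exact congrArg₂ LinearMap.comp (eq_phiLin D F.2) (eq_phiLin D G.2)
  refine WithConv.ext (LinearMap.ext fun x => ?_)
  have h2 := congrArg D.projB (LinearMap.congr_fun h (1 ⊗ₜ x))
  rw [projB_phiLin] at h2
  simpa [right, incl] using h2

lemma right_one (D : YDHopf k H B) : D.right (1 : (B ⊗[k] H) ≃ₗ[k] (B ⊗[k] H)) = 1 := by
  refine WithConv.ext (LinearMap.ext fun x => ?_)
  change D.projB (1 ⊗ₜ x) = algebraMap k B (counit x)
  rw [projB_tmul, Algebra.algebraMap_eq_smul_one]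

/-- `F_R` as an element of `U(H, B)`. -/
def rightUnit (D : YDHopf k H B) (F : D.autHopfProj) : (WithConv (H →ₗ[k] B))ˣ where
  val := D.right F.1
  inv := compConv (D.nu F) (D.right (F⁻¹).1)
  val_inv := by
    have h := congrArg (compConv (D.nu F)) (right_mul D F⁻¹ F)
    rw [inv_mul_cancel, map_mul] at h
    have h1 : compConv (D.nu F) (compConv (D.nu F⁻¹) (D.right F.1)) = D.right F.1 := by
      change compConv (D.nu F * D.nu F⁻¹) (D.right F.1) = _
      rw [← map_mul, mul_inv_cancel, map_one]; rfl
    rw [h1] at h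
    rw [← h]
    exact (congrArg _ (right_one D)).trans (map_one _)
  inv_val := by
    rw [← right_mul, mul_inv_cancel]
    exact right_one D

lemma eq_phi (D : YDHopf k H B) (F : D.autHopfProj) : F.1 = phi (D.nu F) (D.rightUnit F) :=
  LinearEquiv.toLinearMap_injective (eq_phiLin D F.2)

lemma phi_left (D : YDHopf k H B) (f : B ≃ₐ[k] B) (u : (WithConv (H →ₗ[k] B))ˣ)
    (h : phi f u ∈ D.autHopfProj) : D.nu ⟨phi f u, h⟩ = f ∧ D.rightUnit ⟨phi f u, h⟩ = u := by
  have h1 : (u.val).ofConv 1 = 1 := by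
    have h2 := h.1.2.1
    have h3 : phiLin f.toLinearMap u.val (1 ⊗ₜ 1) = (u.val).ofConv 1 ⊗ₜ 1 := by
      rw [phiLin_tmul]
      simp [Bialgebra.comul_one, Algebra.TensorProduct.one_def]
    exact D.tmul_one_injective (h3.symm.trans h2)
  constructor
  · refine AlgEquiv.ext fun b => ?_
    refine (projB_phiLin D f.toLinearMap u.val b 1).trans ?_
    rw [h1, mul_one]; rfl
  · refine Units.ext (WithConv.ext (LinearMap.ext fun x => ?_))
    refine (projB_phiLin D f.toLinearMap u.val 1 x).trans ?_
    simp

/-- The group `N(B, H)` of all `F_R` with `F` in `Aut_Hopf(A, π)` and `F_L = Id_B`, under the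
convolution product. -/
def groupN (D : YDHopf k H B) : Subgroup (WithConv (H →ₗ[k] B))ˣ where
  carrier := {u | ∃ F : D.autHopfProj, D.nu F = 1 ∧ D.rightUnit F = u}
  one_mem' := ⟨1, map_one _, Units.ext (right_one D)⟩
  mul_mem' := by
    rintro _ _ ⟨F, hF, rfl⟩ ⟨G, hG, rfl⟩
    refine ⟨G * F, by rw [map_mul, hF, hG, one_mul], Units.ext ?_⟩
    change D.right (G * F).1 = D.right F.1 * D.right G.1
    rw [right_mul, hG]; rfl
  inv_mem' := by
    rintro _ ⟨F, hF, rfl⟩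
    refine ⟨F⁻¹, by rw [map_inv, hF, inv_one], Units.ext ?_⟩
    change D.right (F⁻¹).1 = compConv (D.nu F) (D.right (F⁻¹).1)
    rw [hF]; rfl

lemma mem_groupN_iff (D : YDHopf k H B) (u : (WithConv (H →ₗ[k] B))ˣ) :
    u ∈ D.groupN ↔ phi 1 u ∈ D.autHopfProj := by
  constructor
  · rintro ⟨F, hF, rfl⟩
    rw [← hF, ← eq_phi]; exact F.2
  · intro h
    exact ⟨⟨_, h⟩, phi_left D 1 u h⟩

set_option synthInstance.maxHeartbeats 200000 in
lemma comult_tmul_map (D : YDHopf k H B) (f : B ≃ₐ[k] B) (hf : f ∈ D.autYD) (b : B) (h : H) :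
    D.comult (f b ⊗ₜ h) = TensorProduct.map (f.toLinearMap.rTensor H) (f.toLinearMap.rTensor H)
      (D.comult (b ⊗ₜ h)) := by
  obtain ⟨-, h2, -, h4⟩ := hf
  have key : ∀ (r : B ⊗[k] (H ⊗[k] B)) (t : H ⊗[k] H),
      (TensorProduct.assoc k B H (B ⊗[k] H)).symm
        (((LinearMap.mul' k H).rTensor (B ⊗[k] H) ∘ₗ
          (TensorProduct.tensorTensorTensorComm k H B H H).toLinearMap).lTensor B
        (TensorProduct.assoc k B (H ⊗[k] B) (H ⊗[k] H)
          (TensorProduct.map f.toLinearMap (f.toLinearMap.lTensor H) r ⊗ₜ t))) =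
      TensorProduct.map (f.toLinearMap.rTensor H) (f.toLinearMap.rTensor H)
        ((TensorProduct.assoc k B H (B ⊗[k] H)).symm
        (((LinearMap.mul' k H).rTensor (B ⊗[k] H) ∘ₗ
          (TensorProduct.tensorTensorTensorComm k H B H H).toLinearMap).lTensor B
        (TensorProduct.assoc k B (H ⊗[k] B) (H ⊗[k] H) (r ⊗ₜ t)))) := by
    intro r t
    induction t using TensorProduct.induction_on with
    | zero => simp
    | add x y hx hy => simp only [map_add, TensorProduct.tmul_add, hx, hy]
    | tmul x y =>
      induction r using TensorProduct.induction_on with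
      | zero => simp
      | add x y hx hy => simp only [map_add, TensorProduct.add_tmul, hx, hy]
      | tmul c s =>
        induction s using TensorProduct.induction_on with
        | zero => simp
        | add x y hx hy =>
          simp only [map_add, TensorProduct.tmul_add, TensorProduct.add_tmul, hx, hy]
        | tmul g e => simp
  have h5 : D.coact.lTensor B (comul (R := k) (f b)) =
      TensorProduct.map f.toLinearMap (f.toLinearMap.lTensor H)
        (D.coact.lTensor B (comul (R := k) b)) := by
    rw [h2]
    generalize comul (R := k) b = t
    induction t using TensorProduct.induction_on with
    | zero => simp
    | add x y hx hy => simp only [map_add, hx, hy]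
    | tmul x y => simp [h4]
  have h6 := key (D.coact.lTensor B (comul (R := k) b)) (comul h)
  rw [← h5] at h6
  simpa only [comult, LinearMap.comp_apply, LinearEquiv.coe_coe, TensorProduct.map_tmul] using h6

lemma phi_mem_of_autYD (D : YDHopf k H B) (f : B ≃ₐ[k] B) (hf : f ∈ D.autYD) :
    phi f (1 : (WithConv (H →ₗ[k] B))ˣ) ∈ D.autHopfProj := by
  have e : ∀ x, phi f (1 : (WithConv (H →ₗ[k] B))ˣ) x = f.toLinearMap.rTensor H x :=
    fun x => LinearMap.congr_fun (phi_one_toLinearMap f) x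
  refine ⟨⟨fun x y => ?_, ?_, fun x => ?_, fun x => ?_⟩, fun x => ?_⟩
  · simp only [e]
    induction x using TensorProduct.induction_on with
    | zero => simp
    | add x y hx hy => simp only [map_add, TensorProduct.add_tmul, hx, hy]
    | tmul b h =>
      induction y using TensorProduct.induction_on with
      | zero => simp
      | add x y hx hy => simp only [map_add, TensorProduct.tmul_add, hx, hy]
      | tmul b' h' =>
        simp only [LinearMap.rTensor_tmul, mul_tmul]
        generalize comul (R := k) h = t
        induction t using TensorProduct.induction_on with
        | zero => simp
        | add x y hx hy => simp only [map_add, hx, hy]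
        | tmul x y => simp [hf.2.2.1]
  · simp [e]
  · rw [phi_one_toLinearMap, e]
    induction x using TensorProduct.induction_on with
    | zero => simp
    | add x y hx hy => simp only [map_add, hx, hy]
    | tmul b h => exact comult_tmul_map D f hf b h
  · rw [e]
    induction x using TensorProduct.induction_on with
    | zero => simp
    | add x y hx hy => simp only [map_add, hx, hy]
    | tmul b h => simp [counitA, hf.1]
  · rw [e]
    induction x using TensorProduct.induction_on with
    | zero => simp
    | add x y hx hy => simp only [map_add, hx, hy]
    | tmul b h => simp [proj, hf.1]

lemma actUnits_mem_of_autYD (D : YDHopf k H B) (f : B ≃ₐ[k] B) (hf : f ∈ D.autYD)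
    (u : (WithConv (H →ₗ[k] B))ˣ) (hu : u ∈ D.groupN) : actUnits f u ∈ D.groupN := by
  rw [mem_groupN_iff] at hu ⊢
  have h := mul_mem (mul_mem (phi_mem_of_autYD D f hf) hu)
    (phi_mem_of_autYD D f⁻¹ (inv_mem hf))
  simpa [phi_mul] using h

/-- The group homomorphism `Φ_YD : N(B, H)^op ⋊_φ Aut_{YD-Hopf}(B) → Aut_Hopf(A, π)`,
`Φ_YD(g, f)(b ⊗ h) = f(b) g(h₍₁₎) ⊗ h₍₂₎`, where `φ(f)(g) = f ∘ g`. -/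
def phiYD (D : YDHopf k H B) :
    (D.groupN)ᵐᵒᵖ ⋊[semiAct D.autYD D.groupN D.actUnits_mem_of_autYD] D.autYD →*
      D.autHopfProj :=
  (phiHom D.autYD D.groupN D.actUnits_mem_of_autYD).codRestrict D.autHopfProj fun x => by
    have h := mul_mem ((mem_groupN_iff D _).1 x.left.unop.2) (phi_mem_of_autYD D _ x.right.2)
    rw [phi_mul, one_mul, actUnits_one, one_mul] at h
    exact h

end YDHopf

namespace YDHopf

variable {k : Type u} {H : Type v} {B : Type w} [Field k] [Ring H] [HopfAlgebra k H]
  [Coalgebra.IsCocomm k H] [CommRing B] [Algebra k B] [Coalgebra k B]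

lemma actUnits_mem_of_range_nu (D : YDHopf k H B) (f : B ≃ₐ[k] B) (hf : f ∈ D.nu.range)
    (u : (WithConv (H →ₗ[k] B))ˣ) (hu : u ∈ D.groupN) : actUnits f u ∈ D.groupN := by
  obtain ⟨F, rfl⟩ := hf
  rw [mem_groupN_iff] at hu ⊢
  have h := mul_mem (mul_mem F.2 hu) (inv_mem F.2)
  have h1 : F.1 * phi 1 u = phi 1 (actUnits (D.nu F) u) * F.1 := by
    rw [eq_phi D F, phi_mul, phi_mul, mul_one, one_mul, actUnits_one]
    congr 1
    exact Units.ext (mul_comm _ _)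
  rwa [h1, mul_inv_cancel_right] at h

/-- For `B` commutative and `H` cocommutative, the group homomorphism
`Φ_ν : N(B, H)^op ⋊_φ Im(ν) → Sym(A)`, `Φ_ν(g, f)(b ⊗ h) = f(b) g(h₍₁₎) ⊗ h₍₂₎`, where
`φ(f)(g) = f ∘ g`. -/
def phiNu (D : YDHopf k H B) :
    (D.groupN)ᵐᵒᵖ ⋊[semiAct D.nu.range D.groupN D.actUnits_mem_of_range_nu] D.nu.range →*
      Equiv.Perm (B ⊗[k] H) where
  toFun x := (phiHom D.nu.range D.groupN D.actUnits_mem_of_range_nu x).toEquiv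
  map_one' := by rw [map_one]; rfl
  map_mul' x y := by rw [map_mul]; rfl

end YDHopf

end

/-! Both failures follow from one automorphism `F` in `Aut_Hopf(A, π)` for which `F_L` does not
respect comultiplication. The right component of any element of the source of `Φ_YD` is a coalgebra
map and equals the `F_L` of its image, so `F` is not in the image. On the other side, `(1, F_L)` is
in the source of `Φ_ν` and goes to `F_L ⊗ id`, and this can be a Hopf map only if `F_L` is a
coalgebra map.

To find `F`, take `B = k[M × ℤ/p]` with the trivial action. Then `A` is `B ⊗ H` as an algebra, and
only its coproduct is twisted. Let `e_y` be the primitive idempotents of `k[ℤ/p]`, indexed by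
characters through a primitive `χ`, and give `m e_y` the degree `r(m) y`, for a homomorphism `r : M
→ ℤ/p`. This degree is additive in `m`, as products require, since `(m e_y)(m' e_y) = m m' e_y`. It
is additive in `y`, as coproducts require, since `Δ(m e_y) = ∑ m e_a ⊗ m e_(y-a)`.

Let `F` scale `m e_y ⊗ c` by `W y m · χ(c y)`; by Fourier inversion `F_R` sends `c` to its copy in
the `ℤ/p` factor of `B`. In the coproduct of `A` the group part of the first leg is shifted by
`r(m)(y - a)`, so `χ` contributes an extra `χ(r(m) a (y - a))`. Hence `F` is comultiplicative when
`W` satisfies `W (a + b) m = W a m · W b m · χ(r(m) a b)` (`diagAut_mem`). But `F_L` scales `m e_y`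
by `W y m`, which is comultiplicative only if `W` is multiplicative in `y`
(`comul_left_diagAut_ne`). Such a `W`, genuinely quadratic in `y`, exists for `M = ℤ/p²`
(`exists_quadratic_characters`). -/

noncomputable section

namespace YDHopf

/-! ### Yetter-Drinfel'd Hopf algebras with trivial action. -/

section OfCoact

variable {k : Type u} {H : Type v} {B : Type w} [Field k] [CommRing H] [HopfAlgebra k H]
  [CommRing B] [HopfAlgebra k B]

variable (k H B) in
/-- The trivial action `h · b = ε(h) b`. -/
def trivialAct : H ⊗[k] B →ₗ[k] B :=
  (TensorProduct.lid k B).toLinearMap ∘ₗ (counit (R := k) (A := H)).rTensor B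

@[simp]
lemma trivialAct_tmul (h : H) (b : B) :
    trivialAct k H B (h ⊗ₜ b) = counit (R := k) h • b := rfl

/-- Serves both the module algebra and the module coalgebra axioms. Here, as in the next lemmas, an
arbitrary tensor `t` replaces `Δ(h)` so that induction on tensors applies; the counit axiom is used
only afterwards. -/
lemma map_trivialAct (t : H ⊗[k] H) (s : B ⊗[k] B) :
    TensorProduct.map (trivialAct k H B) (trivialAct k H B)
      (TensorProduct.tensorTensorTensorComm k H H B B (t ⊗ₜ s)) =
    counit (R := k) (TensorProduct.lid k H ((counit (R := k) (A := H)).rTensor H t)) • s := by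
  induction t using TensorProduct.induction_on with
  | zero => simp
  | add x y hx hy => simp only [map_add, TensorProduct.add_tmul, hx, hy, add_smul]
  | tmul x y =>
    induction s using TensorProduct.induction_on with
    | zero => simp
    | add x y hx hy => simp only [map_add, TensorProduct.tmul_add, hx, hy, smul_add]
    | tmul b b' =>
      simp [TensorProduct.smul_tmul', TensorProduct.tmul_smul, smul_smul, mul_comm]

/-- Left side of the Yetter-Drinfel'd condition: the action evaluates the second leg of `t` by the
counit, leaving a left multiplication on the comodule leg. -/
lemma map_mul_trivialAct (t : H ⊗[k] H) (s : H ⊗[k] B) :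
    TensorProduct.map (LinearMap.mul' k H) (trivialAct k H B)
      (TensorProduct.tensorTensorTensorComm k H H H B (t ⊗ₜ s)) =
    (LinearMap.mulLeft k
      (TensorProduct.rid k H ((counit (R := k) (A := H)).lTensor H t))).rTensor B s := by
  induction s using TensorProduct.induction_on with
  | zero => simp
  | add x y hx hy => simp only [map_add, TensorProduct.tmul_add, hx, hy]
  | tmul g b =>
    induction t using TensorProduct.induction_on with
    | zero => simp
    | add x y hx hy =>
      simp only [map_add, TensorProduct.add_tmul, hx, hy, LinearMap.rTensor_tmul,
        LinearMap.mulLeft_apply, add_mul]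
    | tmul x y => simp [TensorProduct.smul_tmul', TensorProduct.tmul_smul]

-- The braiding in the product on `B ⊗ B` acts through the comodule leg. A trivial action evaluates
-- that leg by the counit, so the braided product becomes the ordinary one.
set_option synthInstance.maxHeartbeats 200000 in
lemma map_trivialAct_mul (s : B ⊗[k] (H ⊗[k] B)) (s' : B ⊗[k] B) :
    (LinearMap.mul' k B).rTensor B
      ((TensorProduct.assoc k B B B).symm
        ((TensorProduct.map (trivialAct k H B) (LinearMap.mul' k B)).lTensor B
          ((TensorProduct.tensorTensorTensorComm k H B B B).toLinearMap.lTensor B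
            (TensorProduct.assoc k B (H ⊗[k] B) (B ⊗[k] B) (s ⊗ₜ s'))))) =
    (trivialAct k H B).lTensor B s * s' := by
  induction s using TensorProduct.induction_on with
  | zero => simp only [map_zero, TensorProduct.zero_tmul, zero_mul]
  | add x y hx hy => simp only [map_add, TensorProduct.add_tmul, hx, hy, add_mul]
  | tmul a r =>
    induction r using TensorProduct.induction_on with
    | zero => simp only [map_zero, TensorProduct.zero_tmul, TensorProduct.tmul_zero, zero_mul]
    | add x y hx hy =>
      simp only [map_add, TensorProduct.add_tmul, TensorProduct.tmul_add, hx, hy, add_mul]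
    | tmul g b =>
      induction s' using TensorProduct.induction_on with
      | zero => simp only [map_zero, TensorProduct.tmul_zero, mul_zero]
      | add x y hx hy => simp only [map_add, TensorProduct.tmul_add, hx, hy, mul_add]
      | tmul x y => simp [TensorProduct.tmul_smul, TensorProduct.smul_tmul']

-- Right side of the Yetter-Drinfel'd condition. Here the surviving leg of `t` multiplies from the
-- right, and commutativity of `H` moves it to the left to match `map_mul_trivialAct`.
set_option synthInstance.maxHeartbeats 200000 in
lemma mul_comp_trivialAct (ρ : B →ₗ[k] H ⊗[k] B) (t : H ⊗[k] H) (b : B) :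
    (LinearMap.mul' k H).rTensor B
      ((TensorProduct.assoc k H H B).symm
        ((TensorProduct.comm k B H).toLinearMap.lTensor H
          (TensorProduct.assoc k H B H
            ((ρ ∘ₗ trivialAct k H B).rTensor H
              ((TensorProduct.comm k H (H ⊗[k] B))
                (TensorProduct.assoc k H H B (TensorProduct.comm k H H t ⊗ₜ b))))))) =
    (LinearMap.mulLeft k
      (TensorProduct.lid k H ((counit (R := k) (A := H)).rTensor H t))).rTensor B (ρ b) := by
  have key : ∀ (x : H) (s : H ⊗[k] B), (LinearMap.mul' k H).rTensor B
      ((TensorProduct.assoc k H H B).symm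
        ((TensorProduct.comm k B H).toLinearMap.lTensor H
          (TensorProduct.assoc k H B H (s ⊗ₜ x)))) = (LinearMap.mulLeft k x).rTensor B s := by
    intro x s
    induction s using TensorProduct.induction_on with
    | zero => simp only [map_zero, TensorProduct.zero_tmul]
    | add x y hx hy => simp only [map_add, TensorProduct.add_tmul, hx, hy]
    | tmul g e => simp [mul_comm]
  induction t using TensorProduct.induction_on with
  | zero =>
    have : LinearMap.mulLeft k (0 : H) = 0 := LinearMap.ext fun x => zero_mul x
    simp only [map_zero, TensorProduct.zero_tmul, this, LinearMap.rTensor_zero,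
      LinearMap.zero_apply]
  | add x y hx hy =>
    have : ∀ x y : H, LinearMap.mulLeft k (x + y) = LinearMap.mulLeft k x + LinearMap.mulLeft k y :=
      fun x y => LinearMap.ext fun z => add_mul x y z
    simp only [map_add, TensorProduct.add_tmul, hx, hy, this, LinearMap.rTensor_add,
      LinearMap.add_apply]
  | tmul x y =>
    have : ∀ (c : k) (x : H), LinearMap.mulLeft k (c • x) = c • LinearMap.mulLeft k x :=
      fun c x => LinearMap.ext fun z => smul_mul_assoc c x z
    simp only [TensorProduct.comm_tmul, TensorProduct.assoc_tmul, LinearMap.rTensor_tmul,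
      LinearMap.comp_apply, trivialAct_tmul, key, TensorProduct.lid_tmul, map_smul, this,
      LinearMap.rTensor_smul, LinearMap.smul_apply]

/-- A commutative Hopf algebra `B` with an `H`-comodule algebra and comodule coalgebra structure
is a Hopf algebra in the Yetter-Drinfel'd category of a commutative Hopf algebra `H`, with the
trivial `H`-action. -/
def ofCoact (ρ : B →ₗ[k] H ⊗[k] B)
    (coassoc : ∀ b : B, TensorProduct.assoc k H H B ((comul (R := k) (A := H)).rTensor B (ρ b)) =
      ρ.lTensor H (ρ b))
    (counit_left : ∀ b : B,
      TensorProduct.lid k B ((counit (R := k) (A := H)).rTensor B (ρ b)) = b)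
    (map_one : ρ 1 = 1 ⊗ₜ 1)
    (map_mul : ∀ b b' : B, ρ (b * b') = ρ b * ρ b')
    (map_counit : ∀ b : B,
      TensorProduct.rid k H ((counit (R := k) (A := B)).lTensor H (ρ b)) =
        algebraMap k H (counit b))
    (map_comul : ∀ b : B,
      (LinearMap.mul' k H).rTensor (B ⊗[k] B)
        (TensorProduct.tensorTensorTensorComm k H B H B
          (TensorProduct.map ρ ρ (comul b))) =
        (comul (R := k) (A := B)).lTensor H (ρ b)) : YDHopf k H B where
  act := trivialAct k H B
  coact := ρ
  one_act b := by simp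
  mul_act h h' b := by simp [smul_smul, mul_comm]
  coact_coassoc := coassoc
  coact_counit := counit_left
  act_one h := by simp [Algebra.algebraMap_eq_smul_one]
  act_mul h b b' := by
    rw [map_trivialAct, Coalgebra.rTensor_counit_comul]
    simp
  coact_one := map_one
  coact_mul := map_mul
  counit_act h b := by simp
  comul_act h b := by
    rw [map_trivialAct, Coalgebra.rTensor_counit_comul]
    simp
  coact_counit' := map_counit
  coact_comul := map_comul
  counit_one := Bialgebra.counit_one
  counit_mul := Bialgebra.counit_mul
  comul_one := by rw [Bialgebra.comul_one, Algebra.TensorProduct.one_def]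
  comul_mul b b' := by
    have h : trivialAct k H B ∘ₗ ρ = LinearMap.id := LinearMap.ext counit_left
    rw [map_trivialAct_mul, ← LinearMap.comp_apply, ← LinearMap.lTensor_comp, h,
      LinearMap.lTensor_id, LinearMap.id_apply, Bialgebra.comul_mul]
  yd h b := by
    rw [map_mul_trivialAct, mul_comp_trivialAct, Coalgebra.lTensor_counit_comul,
      Coalgebra.rTensor_counit_comul]
    simp
  antipode := ⟨⟨WithConv.toConv LinearMap.id,
    WithConv.toConv (HopfAlgebra.antipode k (A := B)),
    LinearMap.id_mul_antipode, LinearMap.antipode_mul_id⟩, rfl⟩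

/-- With trivial action the smash product is the ordinary tensor product algebra, so
multiplicativity can be checked with the ring structure of `B ⊗ H`. -/
lemma mul_ofCoact {ρ : B →ₗ[k] H ⊗[k] B} {h1 h2 h3 h4 h5 h6} (x y : B ⊗[k] H) :
    (ofCoact ρ h1 h2 h3 h4 h5 h6).mul (x ⊗ₜ y) = x * y := by
  induction x using TensorProduct.induction_on with
  | zero => simp
  | add x y hx hy => simp only [map_add, TensorProduct.add_tmul, hx, hy, add_mul]
  | tmul b h =>
    induction y using TensorProduct.induction_on with
    | zero => simp
    | add x y hx hy => simp only [map_add, TensorProduct.tmul_add, hx, hy, mul_add]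
    | tmul b' h' =>
      have key : ∀ t : H ⊗[k] H,
          TensorProduct.map (LinearMap.mulLeft k b ∘ₗ trivialAct k H B ∘ₗ
            (TensorProduct.mk k H B).flip b') (LinearMap.mulRight k h') t =
          (b * b') ⊗ₜ (TensorProduct.lid k H ((counit (R := k) (A := H)).rTensor H t) * h') := by
        intro t
        induction t using TensorProduct.induction_on with
        | zero => simp
        | add x y hx hy => simp only [map_add, TensorProduct.tmul_add, hx, hy, add_mul]
        | tmul x y => simp [TensorProduct.tmul_smul, TensorProduct.smul_tmul']
      rw [mul_tmul]
      refine (key _).trans ?_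
      rw [Coalgebra.rTensor_counit_comul]
      simp

end OfCoact

/-! ### Injectivity, and the consequences of a non-comultiplicative `F_L`. -/

section Reduction

variable {k : Type u} {H : Type v} {B : Type w} [Field k] [Ring H] [HopfAlgebra k H]
  [Ring B] [Algebra k B] [Coalgebra k B]

/-- The automorphism attached to `u` fixes `1 ⊗ 1`, and by its formula it sends it to `u(1) ⊗ 1`. -/
lemma ofConv_one_of_mem_groupN (D : YDHopf k H B) {u : (WithConv (H →ₗ[k] B))ˣ}
    (hu : u ∈ D.groupN) : (u.val).ofConv 1 = 1 := by
  have h2 := ((mem_groupN_iff D u).1 hu).1.2.1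
  have h3 : phiLin (1 : B ≃ₐ[k] B).toLinearMap u.val (1 ⊗ₜ 1) = (u.val).ofConv 1 ⊗ₜ 1 := by
    rw [phiLin_tmul]
    simp [Bialgebra.comul_one, Algebra.TensorProduct.one_def]
  exact D.tmul_one_injective (h3.symm.trans h2)

/-- Composing with `Π` leaves `b ⊗ x ↦ f(b) u(x)`. As `u(1) = 1` and `f(1) = 1`, setting `x = 1`
recovers `f` and setting `b = 1` recovers `u`. -/
lemma phi_injective (D : YDHopf k H B) {f f' : B ≃ₐ[k] B} {u u' : (WithConv (H →ₗ[k] B))ˣ}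
    (hu : u ∈ D.groupN) (hu' : u' ∈ D.groupN) (h : phi f u = phi f' u') : f = f' ∧ u = u' := by
  have e : ∀ b x, f b * u.val.ofConv x = f' b * u'.val.ofConv x := fun b x => by
    have h1 := congrArg (fun F : (B ⊗[k] H) ≃ₗ[k] (B ⊗[k] H) => D.projB (F (b ⊗ₜ x))) h
    exact (projB_phiLin D _ _ b x).symm.trans (h1.trans (projB_phiLin D _ _ b x))
  constructor
  · refine AlgEquiv.ext fun b => ?_
    simpa [ofConv_one_of_mem_groupN D hu, ofConv_one_of_mem_groupN D hu'] using e b 1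
  · refine Units.ext (WithConv.ext (LinearMap.ext fun x => ?_))
    simpa using e 1 x

lemma phiHom_injective (D : YDHopf k H B) (K : Subgroup (B ≃ₐ[k] B))
    (hK : ∀ f ∈ K, ∀ u ∈ D.groupN, actUnits f u ∈ D.groupN) :
    Function.Injective (phiHom K D.groupN hK) := by
  intro x y h
  obtain ⟨h1, h2⟩ := phi_injective D x.left.unop.2 y.left.unop.2 h
  exact SemidirectProduct.ext (MulOpposite.unop_injective (Subtype.ext h2)) (Subtype.ext h1)

lemma phiYD_injective (D : YDHopf k H B) : Function.Injective D.phiYD := fun _ _ h =>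
  phiHom_injective D D.autYD D.actUnits_mem_of_autYD (congrArg Subtype.val h)

/-- If `ν(F)` is not a coalgebra map, then `F` is not in the image of `Φ_YD`. -/
lemma phiYD_not_surjective (D : YDHopf k H B) {F : (B ⊗[k] H) ≃ₗ[k] (B ⊗[k] H)}
    (hF : F ∈ D.autHopfProj) {b : B} (hb : comul (R := k) (D.left F b) ≠
      TensorProduct.map (D.left F) (D.left F) (comul b)) : ¬ Function.Surjective D.phiYD := by
  intro hs
  obtain ⟨x, hx⟩ := hs ⟨F, hF⟩
  have h : phi x.right.1 x.left.unop.1 = F := congrArg Subtype.val hx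
  subst h
  -- The left component of a preimage is forced to be `F_L`, yet it lies in `Aut_{YD-Hopf}(B)`.
  have h1 : D.left (phi x.right.1 x.left.unop.1) = x.right.1.toLinearMap :=
    LinearMap.ext fun b => AlgEquiv.congr_fun (phi_left D _ _ hF).1 b
  rw [h1] at hb
  exact hb (x.right.2.2.1 b)

-- The smash coproduct of `b ⊗ 1` differs from `Δ(b)` only by the coaction, whose `H`-leg `Π` kills
-- through the counit. Thus `Δ_B` can be read off from `A`.
set_option synthInstance.maxHeartbeats 200000 in
lemma map_projB_comult_tmul_one (D : YDHopf k H B) (b : B) :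
    TensorProduct.map D.projB D.projB (D.comult (b ⊗ₜ 1)) = comul (R := k) b := by
  have key : ∀ r : B ⊗[k] B,
      TensorProduct.map D.projB D.projB ((TensorProduct.assoc k B H (B ⊗[k] H)).symm
        (((LinearMap.mul' k H).rTensor (B ⊗[k] H) ∘ₗ
          (TensorProduct.tensorTensorTensorComm k H B H H).toLinearMap).lTensor B
        (TensorProduct.assoc k B (H ⊗[k] B) (H ⊗[k] H)
          (D.coact.lTensor B r ⊗ₜ ((1 : H) ⊗ₜ[k] (1 : H)))))) = r := by
    intro r
    induction r using TensorProduct.induction_on with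
    | zero => simp
    | add x y hx hy => simp only [map_add, TensorProduct.add_tmul, hx, hy]
    | tmul c d =>
      have h1 : ∀ s : H ⊗[k] B,
          TensorProduct.map D.projB D.projB ((TensorProduct.assoc k B H (B ⊗[k] H)).symm
            (c ⊗ₜ (LinearMap.mul' k H).rTensor (B ⊗[k] H)
              (TensorProduct.tensorTensorTensorComm k H B H H (s ⊗ₜ ((1 : H) ⊗ₜ[k] (1 : H)))))) =
          c ⊗ₜ TensorProduct.lid k B ((counit (R := k) (A := H)).rTensor B s) := by
        intro s
        induction s using TensorProduct.induction_on with
        | zero => simp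
        | add x y hx hy => simp only [map_add, TensorProduct.add_tmul, TensorProduct.tmul_add, hx, hy]
        | tmul g e => simp [projB_tmul, TensorProduct.tmul_smul, TensorProduct.smul_tmul']
      have h2 := h1 (D.coact d)
      rw [D.coact_counit] at h2
      simpa using h2
  simpa [comult, Bialgebra.comul_one, Algebra.TensorProduct.one_def] using key (comul b)

/-- If `f ⊗ id` is a Hopf algebra automorphism of the biproduct, then `f` is a coalgebra map. -/
lemma comul_of_phi_one_mem_autHopf (D : YDHopf k H B) {f : B ≃ₐ[k] B}
    (h : phi f (1 : (WithConv (H →ₗ[k] B))ˣ) ∈ D.autHopf) (b : B) :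
    comul (R := k) (f b) = TensorProduct.map f.toLinearMap f.toLinearMap (comul b) := by
  have h3 := congrArg (TensorProduct.map D.projB D.projB) (h.2.2.1 (b ⊗ₜ 1))
  have e : phi f (1 : (WithConv (H →ₗ[k] B))ˣ) (b ⊗ₜ 1) = f b ⊗ₜ 1 :=
    LinearMap.congr_fun (phi_one_toLinearMap f) (b ⊗ₜ 1)
  -- Since `Π` intertwines `f ⊗ id` with `f`, applying `Π ⊗ Π` to comultiplicativity on `b ⊗ 1`
  -- gives comultiplicativity of `f`.
  have e' : D.projB ∘ₗ f.toLinearMap.rTensor H = f.toLinearMap ∘ₗ D.projB :=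
    TensorProduct.ext' fun b x => by simp [projB_tmul]
  rw [e, map_projB_comult_tmul_one, phi_one_toLinearMap, ← LinearMap.comp_apply,
    ← TensorProduct.map_comp, e', TensorProduct.map_comp, LinearMap.comp_apply,
    map_projB_comult_tmul_one] at h3
  exact h3

end Reduction

section ReductionNu

variable {k : Type u} {H : Type v} {B : Type w} [Field k] [Ring H] [HopfAlgebra k H]
  [Coalgebra.IsCocomm k H] [CommRing B] [Algebra k B] [Coalgebra k B]

lemma phiNu_injective (D : YDHopf k H B) : Function.Injective D.phiNu := fun _ _ h =>
  phiHom_injective D D.nu.range D.actUnits_mem_of_range_nu (LinearEquiv.toEquiv_injective h)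

/-- If `ν(F)` is not a coalgebra map, then the image of `Φ_ν` is not contained
in `Aut_Hopf(A, π)`. -/
lemma range_phiNu_not_subset (D : YDHopf k H B) {F : (B ⊗[k] H) ≃ₗ[k] (B ⊗[k] H)}
    (hF : F ∈ D.autHopfProj) {b : B} (hb : comul (R := k) (D.left F b) ≠
      TensorProduct.map (D.left F) (D.left F) (comul b)) :
    ¬ Set.range D.phiNu ⊆ {σ | ∃ F ∈ D.autHopfProj, σ = F.toEquiv} := by
  intro hs
  -- The offending element is the pair of the convolution unit and `ν(F)`, whose image is `F_L ⊗
  -- id`.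
  obtain ⟨F', hF', h⟩ := hs ⟨⟨1, ⟨D.nu ⟨F, hF⟩, ⟨F, hF⟩, rfl⟩⟩, rfl⟩
  have h' : phi (D.nu ⟨F, hF⟩) (1 : (WithConv (H →ₗ[k] B))ˣ) = F' :=
    LinearEquiv.toEquiv_injective h
  rw [← h'] at hF'
  exact hb (comul_of_phi_one_mem_autHopf D hF'.1 b)

end ReductionNu

end YDHopf

/-! ### Quadratic functions on `ℤ/p` with values in roots of unity. -/

section Character

variable {k : Type u} [Field k]

/-- The function `n ↦ μⁿ ζ^(n choose 2)`. -/
def quadChar (μ ζ : k) (n : ℕ) : k := μ ^ n * ζ ^ n.choose 2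

/-- The binomial `n choose 2` is a quadratic function whose polarisation is `m n`. -/
lemma quadChar_add (μ ζ : k) (m n : ℕ) :
    quadChar μ ζ (m + n) = quadChar μ ζ m * quadChar μ ζ n * ζ ^ (m * n) := by
  have h : (m + n).choose 2 = m.choose 2 + n.choose 2 + m * n := by
    simp only [Nat.add_choose_eq, Finset.Nat.antidiagonal_succ, Finset.Nat.antidiagonal_zero,
      Finset.map_singleton, Finset.map_cons, Finset.sum_cons, Finset.sum_singleton]
    simp
    ring
  rw [quadChar, quadChar, quadChar, h]
  ring

/-- Adding a multiple of `p` gives a cross term that is a power of `ζ ^ p = 1`, so the value `1` at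
`p` already forces `p`-periodicity. -/
lemma quadChar_mod {p : ℕ} {μ ζ : k} (hζ : ζ ^ p = 1) (h : quadChar μ ζ p = 1) (n : ℕ) :
    quadChar μ ζ (n % p) = quadChar μ ζ n := by
  have h1 : ∀ q, quadChar μ ζ (p * q) = 1 := by
    intro q
    induction q with
    | zero => simp [quadChar]
    | succ q ih => rw [Nat.mul_succ, quadChar_add, ih, h, pow_mul', hζ]; simp
  conv_rhs => rw [← Nat.mod_add_div n p, quadChar_add, h1, mul_one, mul_left_comm, pow_mul, hζ,
    one_pow, mul_one]

/-- The relation between a symmetric bicharacter of `ℤ/p` and a quadratic refinement of it whose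
values are `p²`-th roots of unity. -/
lemma exists_quadratic_refinement [IsAlgClosed k] [CharZero k] (p : ℕ) [Fact p.Prime] :
    ∃ (χ : AddChar (ZMod p) k) (w : ZMod p → k), χ.IsPrimitive ∧ (∀ a, w a ^ (p ^ 2) = 1) ∧
      ∀ a b, w (a + b) = w a * w b * χ (a * b) := by
  have hp : 0 < p := (Fact.out : p.Prime).pos
  have : NeZero (p : k) := ⟨Nat.cast_ne_zero.2 hp.ne'⟩
  obtain ⟨ζ, hζ⟩ := HasEnoughRootsOfUnity.exists_primitiveRoot k p
  -- This `μ` normalises the value at `p` to `1`. In general it is only a `p²`-th root of unity: for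
  -- `p = 2` one has `ζ = -1` and `μ² = -1`. This is why `p²` appears uniformly in `p`.
  obtain ⟨μ, hμ⟩ := IsAlgClosed.exists_pow_nat_eq (ζ⁻¹ ^ p.choose 2) hp
  have h1 : quadChar μ ζ p = 1 := by
    rw [quadChar, hμ, ← mul_pow, inv_mul_cancel₀ (hζ.ne_zero hp.ne'), one_pow]
  refine ⟨AddChar.zmodChar p hζ.pow_eq_one, fun a => quadChar μ ζ a.val,
    AddChar.zmodChar_primitive_of_primitive_root p hζ, fun a => ?_, fun a b => ?_⟩
  · have h2 : μ ^ (p ^ 2) = 1 := by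
      rw [pow_two, pow_mul, hμ, ← pow_mul, mul_comm, pow_mul, inv_pow, hζ.pow_eq_one]
      simp
    have h3 : ζ ^ (p ^ 2) = 1 := by rw [pow_two, pow_mul, hζ.pow_eq_one, one_pow]
    change (μ ^ a.val * ζ ^ a.val.choose 2) ^ p ^ 2 = 1
    rw [mul_pow, ← pow_mul, ← pow_mul, mul_comm _ (p ^ 2), mul_comm _ (p ^ 2), pow_mul,
      pow_mul, h2, h3, one_pow, one_pow, one_mul]
  · change quadChar μ ζ (a + b).val = _
    rw [ZMod.val_add, quadChar_mod hζ.pow_eq_one h1, quadChar_add, AddChar.zmodChar_apply,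
      ZMod.val_mul, ← pow_eq_pow_mod _ hζ.pow_eq_one]

end Character

/-! ### Fourier transform on the `ℤ/p` factor of `k[M × ℤ/p]`. -/

section HomogeneousBasis

variable {k : Type u} [Field k] {p : ℕ} [Fact p.Prime] {M : Type*} [CommGroup M]

/-- The product of the group element `m` and of the primitive idempotent of `k[ℤ/p]` on which
`ℤ/p` acts by the character `c ↦ χ(c y)`. -/
def homog (χ : AddChar (ZMod p) k) (m : M) (y : ZMod p) :
    MonoidAlgebra k (M × Multiplicative (ZMod p)) :=
  (p : k)⁻¹ • ∑ c : ZMod p, χ (-(c * y)) • .single (m, .ofAdd c) 1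

lemma sum_addChar_mul {χ : AddChar (ZMod p) k} (hχ : χ.IsPrimitive) (a : ZMod p) :
    ∑ c : ZMod p, χ (c * a) = if a = 0 then (p : k) else 0 := by
  simpa using AddChar.sum_mulShift a hχ

variable [CharZero k]

/-- Fourier inversion, from orthogonality of characters. -/
lemma sum_homog {χ : AddChar (ZMod p) k} (hχ : χ.IsPrimitive) (m : M) (c : ZMod p) :
    ∑ y, χ (c * y) • homog χ m y = .single (m, .ofAdd c) 1 := by
  simp only [homog, Finset.smul_sum, smul_smul]
  rw [Finset.sum_comm]
  have h : ∀ d y : ZMod p, χ (c * y) * ((p : k)⁻¹ * χ (-(d * y))) =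
      (p : k)⁻¹ * χ (y * (c - d)) := fun d y => by
    rw [mul_left_comm, ← AddChar.map_add_eq_mul]; ring_nf
  simp only [h, ← Finset.sum_smul, ← Finset.mul_sum, sum_addChar_mul hχ, sub_eq_zero]
  rw [Finset.sum_eq_single c (fun d _ hd => by rw [if_neg (Ne.symm hd)]; simp) (by simp)]
  simp

lemma homog_mul_homog {χ : AddChar (ZMod p) k} (hχ : χ.IsPrimitive) (m m' : M) (y y' : ZMod p) :
    homog χ m y * homog χ m' y' = if y = y' then homog χ (m * m') y else 0 := by
  -- The idempotent is an eigenvector for multiplication by `c`: translate the summation index by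
  -- `c`. Summing over `c`, orthogonality then separates `y` from `y'`.
  have h1 : ∀ c, MonoidAlgebra.single (m, .ofAdd c) 1 * homog χ m' y' =
      χ (c * y') • homog χ (m * m') y' := by
    intro c
    simp only [homog, mul_smul_comm, Finset.mul_sum, MonoidAlgebra.single_mul_single, mul_one]
    rw [smul_comm]
    congr 1
    rw [Finset.smul_sum, ← Equiv.sum_comp (Equiv.addLeft c) fun d => χ (c * y') •
      χ (-(d * y')) • MonoidAlgebra.single (m * m', Multiplicative.ofAdd d) (1 : k)]
    refine Finset.sum_congr rfl fun d _ => ?_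
    rw [smul_smul, ← AddChar.map_add_eq_mul, Equiv.coe_addLeft]
    have e : c * y' + -((c + d) * y') = -(d * y') := by ring
    rw [e]
    rfl
  conv_lhs => rw [homog]
  simp only [smul_mul_assoc, Finset.sum_mul, h1, smul_smul, ← Finset.sum_smul]
  have h2 : ∀ c, χ (-(c * y)) * χ (c * y') = χ (c * (y' - y)) := fun c => by
    rw [← AddChar.map_add_eq_mul]; ring_nf
  simp only [h2, sum_addChar_mul hχ, sub_eq_zero]
  by_cases h : y = y'
  · subst h; simp
  · simp [h, Ne.symm h]

lemma counit_homog {χ : AddChar (ZMod p) k} (hχ : χ.IsPrimitive) (m : M) (y : ZMod p) :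
    counit (R := k) (homog χ m y) = if y = 0 then 1 else 0 := by
  have h := sum_addChar_mul hχ (-y)
  simp only [neg_eq_zero, mul_neg] at h
  simp only [homog, map_smul, map_sum, MonoidAlgebra.counit_single, CommSemiring.counit_apply,
    smul_eq_mul, mul_one, h]
  split_ifs <;> simp

/-- Expand both legs of the group-like `(m, c)` by Fourier inversion; summing over `c` keeps only
the terms with `a + b = y`. -/
lemma comul_homog {χ : AddChar (ZMod p) k} (hχ : χ.IsPrimitive) (m : M) (y : ZMod p) :
    comul (R := k) (homog χ m y) = ∑ a, homog χ m a ⊗ₜ[k] homog χ m (y - a) := by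
  have h1 : ∀ c, comul (R := k) (MonoidAlgebra.single (m, Multiplicative.ofAdd c) (1 : k)) =
      ∑ a, ∑ b, χ (c * (a + b)) • (homog χ m a ⊗ₜ[k] homog χ m b) := by
    intro c
    rw [MonoidAlgebra.comul_single, CommSemiring.comul_apply, TensorProduct.map_tmul,
      MonoidAlgebra.lsingle_apply, ← sum_homog hχ, TensorProduct.sum_tmul]
    refine Finset.sum_congr rfl fun a _ => ?_
    rw [TensorProduct.tmul_sum]
    refine Finset.sum_congr rfl fun b _ => ?_
    rw [TensorProduct.smul_tmul_smul, mul_add, AddChar.map_add_eq_mul]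
  conv_lhs => rw [homog]
  simp only [map_smul, map_sum, h1, Finset.smul_sum, smul_smul, mul_assoc]
  rw [Finset.sum_comm]
  refine Finset.sum_congr rfl fun a _ => ?_
  rw [Finset.sum_comm]
  have h2 : ∀ b c : ZMod p, (p : k)⁻¹ * (χ (-(c * y)) * χ (c * (a + b))) =
      (p : k)⁻¹ * χ (c * (a + b - y)) := fun b c => by
    rw [← AddChar.map_add_eq_mul]; ring_nf
  simp only [h2, ← Finset.sum_smul, ← Finset.mul_sum, sum_addChar_mul hχ]
  rw [Finset.sum_eq_single (y - a)]
  · simp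
  · intro b _ hb
    rw [if_neg, mul_zero, zero_smul]
    contrapose! hb
    linear_combination hb
  · simp

lemma sum_homog_one {χ : AddChar (ZMod p) k} (hχ : χ.IsPrimitive) :
    ∑ y, homog χ (1 : M) y = 1 := by
  have h := sum_homog hχ (1 : M) 0
  simp only [zero_mul, AddChar.map_zero_eq_one, one_smul] at h
  exact h

/-- The basis of `k[M × ℤ/p]` of elements which are homogeneous for the grading by characters
of `ℤ/p`. -/
def homogBasis [Fintype M] {χ : AddChar (ZMod p) k} (hχ : χ.IsPrimitive) :
    Module.Basis (M × ZMod p) k (MonoidAlgebra k (M × Multiplicative (ZMod p))) :=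
  basisOfTopLeSpanOfCardEqFinrank (fun x : M × ZMod p => homog χ x.1 x.2)
    (by
      intro b _
      induction b using MonoidAlgebra.induction_linear with
      | zero => exact zero_mem _
      | add f g hf hg => exact add_mem (hf trivial) (hg trivial)
      | single x c =>
        have h : MonoidAlgebra.single x c =
            c • ∑ y, χ (x.2.toAdd * y) • homog χ x.1 y := by
          rw [sum_homog hχ]; simp
        rw [h]
        exact Submodule.smul_mem _ _ (Submodule.sum_mem _ fun y _ => Submodule.smul_mem _ _
          (Submodule.subset_span ⟨(x.1, y), rfl⟩)))
    (by
      rw [(MonoidAlgebra.coeffLinearEquiv k).finrank_eq, Module.finrank_finsupp_self]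
      simp only [Fintype.card_prod, Fintype.card_multiplicative])

@[simp]
lemma homogBasis_apply [Fintype M] {χ : AddChar (ZMod p) k} (hχ : χ.IsPrimitive)
    (x : M × ZMod p) : homogBasis hχ x = homog χ x.1 x.2 := by
  simp [homogBasis]

end HomogeneousBasis

/-- An induction principle for a module with a basis. -/
lemma basis_induction {ι R V : Type*} [Semiring R] [AddCommMonoid V] [Module R V]
    (b : Module.Basis ι R V) {P : V → Prop} (zero : P 0) (add : ∀ x y, P x → P y → P (x + y))
    (smul : ∀ (c : R) x, P x → P (c • x)) (basis : ∀ i, P (b i)) (x : V) : P x := by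
  have h := b.mem_span x
  induction h using Submodule.span_induction with
  | mem x h => obtain ⟨i, rfl⟩ := h; exact basis i
  | zero => exact zero
  | add x y _ _ hx hy => exact add x y hx hy
  | smul c x _ hx => exact smul c x hx

/-- The basis of the group algebra `k[ℤ/p]` of the group elements. -/
def groupBasis (k : Type u) [Field k] (p : ℕ) : Module.Basis (Multiplicative (ZMod p)) k
    (MonoidAlgebra k (Multiplicative (ZMod p))) := .ofRepr (MonoidAlgebra.coeffLinearEquiv k)

@[simp]
lemma groupBasis_apply (k : Type u) [Field k] (p : ℕ) (c : Multiplicative (ZMod p)) :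
    groupBasis k p c = MonoidAlgebra.single c 1 := rfl

/-- At `a = b = 0` the relation says that the unit `W 0 m` is idempotent. This gives compatibility
with `ε` and `π`, which see only `y = 0`. -/
lemma map_zero_of_quadratic {k : Type u} [Field k] {p : ℕ} {M : Type*} [CommGroup M]
    {χ : AddChar (ZMod p) k}
    {r : M →* Multiplicative (ZMod p)} {W : ZMod p → M →* k}
    (hW : ∀ a b m, W (a + b) m = W a m * W b m * χ ((r m).toAdd * (a * b))) (m : M) :
    W 0 m = 1 := by
  have h := hW 0 0 m
  rw [add_zero, mul_zero, mul_zero, AddChar.map_zero_eq_one, mul_one] at h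
  exact (mul_eq_left₀ ((Group.isUnit m).map (W 0)).ne_zero).1 h.symm

/-! ### The biproduct and its diagonal automorphism. -/

section Example

variable {k : Type u} [Field k] [CharZero k] {p : ℕ} [Fact p.Prime]
  {M : Type*} [CommGroup M] [Fintype M]

@[elab_as_elim]
lemma homog_induction {χ : AddChar (ZMod p) k} (hχ : χ.IsPrimitive)
    {P : MonoidAlgebra k (M × Multiplicative (ZMod p)) → Prop} (zero : P 0)
    (add : ∀ x y, P x → P y → P (x + y)) (smul : ∀ (c : k) x, P x → P (c • x))
    (homog : ∀ m y, P (homog χ m y)) (x : MonoidAlgebra k (M × Multiplicative (ZMod p))) : P x :=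
  basis_induction (homogBasis hχ) zero add smul
    (fun i => by rw [homogBasis_apply]; exact homog _ _) x

/-- The `k[ℤ/p]`-comodule structure on `k[M × ℤ/p]` for which `homog χ m y` is homogeneous of
degree `r(m) y`. -/
def homogCoact {χ : AddChar (ZMod p) k} (hχ : χ.IsPrimitive)
    (r : M →* Multiplicative (ZMod p)) :
    MonoidAlgebra k (M × Multiplicative (ZMod p)) →ₗ[k]
      MonoidAlgebra k (Multiplicative (ZMod p)) ⊗[k]
        MonoidAlgebra k (M × Multiplicative (ZMod p)) :=
  (homogBasis hχ).constr k fun x =>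
    .single (.ofAdd ((r x.1).toAdd * x.2)) 1 ⊗ₜ homog χ x.1 x.2

lemma homogCoact_homog {χ : AddChar (ZMod p) k} (hχ : χ.IsPrimitive)
    (r : M →* Multiplicative (ZMod p)) (m : M) (y : ZMod p) :
    homogCoact hχ r (homog χ m y) = .single (.ofAdd ((r m).toAdd * y)) 1 ⊗ₜ homog χ m y := by
  have h := (homogBasis hχ).constr_basis k (fun x : M × ZMod p =>
    MonoidAlgebra.single (Multiplicative.ofAdd ((r x.1).toAdd * x.2)) (1 : k) ⊗ₜ[k] homog χ x.1 x.2) (m, y)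
  rwa [homogBasis_apply] at h

/-- Nonzero products of basis elements have a common `y`, and for fixed `y` the degree `r(m) y` is
additive in `m`. -/
lemma homogCoact_mul {χ : AddChar (ZMod p) k} (hχ : χ.IsPrimitive)
    (r : M →* Multiplicative (ZMod p)) (b b' : MonoidAlgebra k (M × Multiplicative (ZMod p))) :
    homogCoact hχ r (b * b') = homogCoact hχ r b * homogCoact hχ r b' := by
  refine homog_induction hχ ?_ (fun x y hx hy => ?_) (fun c x hx => ?_)
    (fun m y => ?_) b
  · simp
  · simp only [map_add, add_mul, hx, hy]
  · simp only [map_smul, smul_mul_assoc, hx]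
  · refine homog_induction hχ ?_ (fun x y hx hy => ?_) (fun c x hx => ?_)
      (fun m' y' => ?_) b'
    · simp
    · simp only [map_add, mul_add, hx, hy]
    · simp only [map_smul, mul_smul_comm, hx]
    · simp only [homogCoact_homog, homog_mul_homog hχ,
        Algebra.TensorProduct.tmul_mul_tmul, MonoidAlgebra.single_mul_single, mul_one]
      split_ifs with h
      · rw [homogCoact_homog, ← h, map_mul r, toAdd_mul, add_mul, ofAdd_add]
      · simp

-- For fixed `m` the degree is additive in `y`: `r(m) a + r(m) (y - a) = r(m) y`.
set_option synthInstance.maxHeartbeats 200000 in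
lemma homogCoact_comul {χ : AddChar (ZMod p) k} (hχ : χ.IsPrimitive)
    (r : M →* Multiplicative (ZMod p)) (b : MonoidAlgebra k (M × Multiplicative (ZMod p))) :
    (LinearMap.mul' k (MonoidAlgebra k (Multiplicative (ZMod p)))).rTensor _
      (TensorProduct.tensorTensorTensorComm k _ _ _ _
        (TensorProduct.map (homogCoact hχ r) (homogCoact hχ r) (comul b))) =
    (comul (R := k)).lTensor _ (homogCoact hχ r b) := by
  refine homog_induction hχ ?_ (fun x y hx hy => ?_) (fun c x hx => ?_)
    (fun m y => ?_) b
  · simp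
  · simp only [map_add, hx, hy]
  · simp only [map_smul, hx]
  · simp only [homogCoact_homog, comul_homog hχ, map_sum,
      TensorProduct.map_tmul, TensorProduct.tensorTensorTensorComm_tmul, LinearMap.rTensor_tmul,
      LinearMap.lTensor_tmul, TensorProduct.tmul_sum, LinearMap.mul'_apply,
      MonoidAlgebra.single_mul_single, mul_one, ← ofAdd_add, ← mul_add, add_sub_cancel]

/-- The group algebra `k[M × ℤ/p]` with trivial `k[ℤ/p]`-action and the coaction of
`homogCoact`. -/
def homogYD {χ : AddChar (ZMod p) k} (hχ : χ.IsPrimitive) (r : M →* Multiplicative (ZMod p)) :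
    YDHopf k (MonoidAlgebra k (Multiplicative (ZMod p)))
      (MonoidAlgebra k (M × Multiplicative (ZMod p))) :=
  YDHopf.ofCoact (homogCoact hχ r)
    (fun b => by
      refine homog_induction hχ ?_ (fun x y hx hy => ?_) (fun c x hx => ?_)
        (fun m y => ?_) b
      · simp
      · simp only [map_add, hx, hy]
      · simp only [map_smul, hx]
      · simp [homogCoact_homog])
    (fun b => by
      refine homog_induction hχ ?_ (fun x y hx hy => ?_) (fun c x hx => ?_)
        (fun m y => ?_) b
      · simp
      · simp only [map_add, hx, hy]
      · simp only [map_smul, hx]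
      · simp [homogCoact_homog])
    (by
      -- The unit is the sum of the idempotents with `m = 1`, all of degree `r(1) y = 0`.
      rw [← sum_homog_one hχ, map_sum, TensorProduct.tmul_sum]
      simp only [homogCoact_homog, map_one, toAdd_one, zero_mul, ofAdd_zero]
      rfl)
    (homogCoact_mul hχ r)
    (fun b => by
      refine homog_induction hχ ?_ (fun x y hx hy => ?_) (fun c x hx => ?_)
        (fun m y => ?_) b
      · simp
      · simp only [map_add, hx, hy]
      · simp only [map_smul, hx, Algebra.algebraMap_eq_smul_one, smul_assoc]
      -- The counit vanishes unless `y = 0`, where the degree is `0`.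
      · simp only [homogCoact_homog, LinearMap.lTensor_tmul,
          counit_homog hχ, TensorProduct.rid_tmul]
        split_ifs with h
        · simp [h]
        · simp)
    (homogCoact_comul hχ r)

@[elab_as_elim]
lemma homog_tmul_induction {χ : AddChar (ZMod p) k} (hχ : χ.IsPrimitive)
    {P : MonoidAlgebra k (M × Multiplicative (ZMod p)) ⊗[k]
      MonoidAlgebra k (Multiplicative (ZMod p)) → Prop} (zero : P 0)
    (add : ∀ x y, P x → P y → P (x + y)) (smul : ∀ (c : k) x, P x → P (c • x))
    (tmul : ∀ m y c, P (homog χ m y ⊗ₜ .single c 1))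
    (x : MonoidAlgebra k (M × Multiplicative (ZMod p)) ⊗[k]
      MonoidAlgebra k (Multiplicative (ZMod p))) : P x :=
  basis_induction ((homogBasis hχ).tensorProduct (groupBasis k p)) zero add smul
    (fun i => by
      rw [Module.Basis.tensorProduct_apply, homogBasis_apply, groupBasis_apply]
      exact tmul _ _ _) x

/-- The automorphism of `k[M × ℤ/p] ⊗ k[ℤ/p]` which multiplies `homog χ m y ⊗ c` by
`W y m χ(c y)`. -/
def diagAut {χ : AddChar (ZMod p) k} (hχ : χ.IsPrimitive) (W : ZMod p → M →* k) :
    (MonoidAlgebra k (M × Multiplicative (ZMod p)) ⊗[k]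
      MonoidAlgebra k (Multiplicative (ZMod p))) ≃ₗ[k]
    (MonoidAlgebra k (M × Multiplicative (ZMod p)) ⊗[k]
      MonoidAlgebra k (Multiplicative (ZMod p))) :=
  ((homogBasis hχ).tensorProduct (groupBasis k p)).equiv
    (((homogBasis hχ).tensorProduct (groupBasis k p)).isUnitSMul
      (w := fun x => W x.1.2 x.1.1 * χ (x.2.toAdd * x.1.2))
      fun x => ((Group.isUnit x.1.1).map (W x.1.2)).mul (χ.val_isUnit _))
    (Equiv.refl _)

lemma diagAut_tmul {χ : AddChar (ZMod p) k} (hχ : χ.IsPrimitive) (W : ZMod p → M →* k)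
    (m : M) (y : ZMod p) (c : Multiplicative (ZMod p)) :
    diagAut hχ W (homog χ m y ⊗ₜ .single c 1) =
      (W y m * χ (c.toAdd * y)) • (homog χ m y ⊗ₜ .single c 1) := by
  have h := ((homogBasis hχ).tensorProduct (groupBasis k p)).equiv_apply ((m, y), c)
    (((homogBasis hχ).tensorProduct (groupBasis k p)).isUnitSMul
      (w := fun x => W x.1.2 x.1.1 * χ (x.2.toAdd * x.1.2))
      fun x => ((Group.isUnit x.1.1).map (W x.1.2)).mul (χ.val_isUnit _))
    (Equiv.refl _)
  simp only [Module.Basis.tensorProduct_apply, homogBasis_apply, groupBasis_apply,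
    Equiv.refl_apply, Module.Basis.isUnitSMul_apply] at h
  exact h

/-- Different `y` are orthogonal, so the scalars need only be multiplicative in `m` and `c` for
fixed `y`; no condition on `W` as a function of `y` arises. -/
lemma diagAut_mul {χ : AddChar (ZMod p) k} (hχ : χ.IsPrimitive) (W : ZMod p → M →* k)
    (x z : MonoidAlgebra k (M × Multiplicative (ZMod p)) ⊗[k]
      MonoidAlgebra k (Multiplicative (ZMod p))) :
    diagAut hχ W (x * z) = diagAut hχ W x * diagAut hχ W z := by
  refine homog_tmul_induction hχ ?_ (fun x y hx hy => ?_) (fun c x hx => ?_)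
    (fun m y c => ?_) x
  · simp
  · simp only [map_add, add_mul, hx, hy]
  · simp only [map_smul, smul_mul_assoc, hx]
  · refine homog_tmul_induction hχ ?_ (fun x y hx hy => ?_) (fun c x hx => ?_)
      (fun m' y' c' => ?_) z
    · simp
    · simp only [map_add, mul_add, hx, hy]
    · simp only [map_smul, mul_smul_comm, hx]
    · simp only [diagAut_tmul, smul_mul_smul_comm, Algebra.TensorProduct.tmul_mul_tmul,
        homog_mul_homog hχ, MonoidAlgebra.single_mul_single, mul_one]
      split_ifs with h
      · rw [diagAut_tmul, ← h, map_mul, toAdd_mul, add_mul, AddChar.map_add_eq_mul,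
          mul_mul_mul_comm]
      · simp

set_option synthInstance.maxHeartbeats 200000 in
lemma comult_homogYD_tmul {χ : AddChar (ZMod p) k} (hχ : χ.IsPrimitive)
    (r : M →* Multiplicative (ZMod p)) (m : M) (y : ZMod p) (c : Multiplicative (ZMod p)) :
    (homogYD hχ r).comult (homog χ m y ⊗ₜ .single c 1) =
      ∑ a, (homog χ m a ⊗ₜ .single (.ofAdd ((r m).toAdd * (y - a)) * c) 1) ⊗ₜ
        (homog χ m (y - a) ⊗ₜ .single c 1) := by
  have h : (homogYD hχ r).coact = homogCoact hχ r := rfl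
  simp only [YDHopf.comult, LinearMap.comp_apply, TensorProduct.map_tmul, comul_homog hχ,
    LinearEquiv.coe_coe, map_sum, LinearMap.lTensor_tmul, h, homogCoact_homog,
    MonoidAlgebra.comul_single, CommSemiring.comul_apply, MonoidAlgebra.lsingle_apply,
    TensorProduct.sum_tmul, TensorProduct.assoc_tmul,
    TensorProduct.tensorTensorTensorComm_tmul, LinearMap.rTensor_tmul, LinearMap.mul'_apply,
    MonoidAlgebra.single_mul_single, mul_one, TensorProduct.assoc_symm_tmul]

set_option synthInstance.maxHeartbeats 200000 in
lemma diagAut_mem {χ : AddChar (ZMod p) k} (hχ : χ.IsPrimitive)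
    {r : M →* Multiplicative (ZMod p)} {W : ZMod p → M →* k}
    (hW : ∀ a b m, W (a + b) m = W a m * W b m * χ ((r m).toAdd * (a * b))) :
    diagAut hχ W ∈ (homogYD hχ r).autHopfProj := by
  refine ⟨⟨fun x y => ?_, ?_, fun x => ?_, fun x => ?_⟩, fun x => ?_⟩
  · rw [homogYD, YDHopf.mul_ofCoact, YDHopf.mul_ofCoact, diagAut_mul]
  · rw [← sum_homog_one hχ, TensorProduct.sum_tmul, map_sum, MonoidAlgebra.one_def]
    refine Finset.sum_congr rfl fun y _ => ?_
    rw [diagAut_tmul]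
    simp
  · refine homog_tmul_induction hχ ?_ (fun x y hx hy => ?_) (fun c x hx => ?_)
      (fun m y c => ?_) x
    · simp only [map_zero]
    · simp only [map_add, hx, hy]
    · simp only [map_smul, hx]
    · simp only [diagAut_tmul, comult_homogYD_tmul, map_smul, map_sum, Finset.smul_sum,
        TensorProduct.map_tmul, LinearEquiv.coe_coe, TensorProduct.smul_tmul_smul]
      refine Finset.sum_congr rfl fun a _ => ?_
      congr 1
      have h1 := hW a (y - a) m
      rw [add_sub_cancel] at h1
      have h2 : χ (c.toAdd * y) = χ (c.toAdd * a) * χ (c.toAdd * (y - a)) := by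
        rw [← AddChar.map_add_eq_mul, ← mul_add, add_sub_cancel]
      -- The degree shift in the first leg yields exactly the cross term by which `W` fails to be
      -- multiplicative in `y`.
      have h3 : χ ((Multiplicative.ofAdd ((r m).toAdd * (y - a)) * c).toAdd * a) =
          χ ((r m).toAdd * (a * (y - a))) * χ (c.toAdd * a) := by
        rw [← AddChar.map_add_eq_mul, toAdd_mul, toAdd_ofAdd]
        congr 1
        ring
      rw [h1, h2, h3]
      ring
  · refine homog_tmul_induction hχ ?_ (fun x y hx hy => ?_) (fun c x hx => ?_)
      (fun m y c => ?_) x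
    · simp only [map_zero]
    · simp only [map_add, hx, hy]
    · simp only [map_smul, hx]
    · simp only [diagAut_tmul, map_smul, YDHopf.counitA, LinearMap.comp_apply, TensorProduct.map_tmul,
        counit_homog hχ]
      by_cases h : y = 0
      · simp [h, map_zero_of_quadratic hW]
      · simp [h]
  · refine homog_tmul_induction hχ ?_ (fun x y hx hy => ?_) (fun c x hx => ?_)
      (fun m y c => ?_) x
    · simp only [map_zero]
    · simp only [map_add, hx, hy]
    · simp only [map_smul, hx]
    · simp only [diagAut_tmul, map_smul, YDHopf.proj, LinearMap.comp_apply, LinearMap.rTensor_tmul,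
        counit_homog hχ]
      by_cases h : y = 0
      · simp [h, map_zero_of_quadratic hW]
      · simp [h]

lemma left_diagAut {χ : AddChar (ZMod p) k} (hχ : χ.IsPrimitive)
    (r : M →* Multiplicative (ZMod p)) (W : ZMod p → M →* k) (m : M) (y : ZMod p) :
    (homogYD hχ r).left (diagAut hχ W) (homog χ m y) = W y m • homog χ m y := by
  have h : (homogYD hχ r).inclB (homog χ m y) = homog χ m y ⊗ₜ .single 1 1 := rfl
  rw [YDHopf.left, LinearMap.comp_apply, LinearMap.comp_apply, h, LinearEquiv.coe_coe,
    diagAut_tmul, map_smul, YDHopf.projB_tmul]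
  simp

/-- Compare the coefficients of `homog χ m a ⊗ homog χ m b`: they are `W (a + b) m` and `W a m * W b
m`. -/
lemma comul_left_diagAut_ne {χ : AddChar (ZMod p) k} (hχ : χ.IsPrimitive)
    (r : M →* Multiplicative (ZMod p)) {W : ZMod p → M →* k} {a b : ZMod p} {m : M}
    (h : W (a + b) m ≠ W a m * W b m) :
    comul (R := k) ((homogYD hχ r).left (diagAut hχ W) (homog χ m (a + b))) ≠
      TensorProduct.map ((homogYD hχ r).left (diagAut hχ W))
        ((homogYD hχ r).left (diagAut hχ W)) (comul (homog χ m (a + b))) := by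
  classical
  have h1 : ∀ y z : ZMod p, (homogBasis hχ).repr (homog χ m y) (m, z) = if y = z then 1 else 0 := by
    intro y z
    rw [← homogBasis_apply hχ (m, y), Module.Basis.repr_self, Finsupp.single_apply]
    simp
  intro e
  have e' := congrArg (fun t =>
    ((homogBasis hχ).tensorProduct (homogBasis hχ)).repr t ((m, a), (m, b))) e
  simp only [left_diagAut, map_smul, comul_homog hχ, map_sum, TensorProduct.map_tmul,
    TensorProduct.smul_tmul_smul, Finsupp.smul_apply, Finsupp.finsetSum_apply,
    Module.Basis.tensorProduct_repr_tmul_apply, h1] at e'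
  refine h ?_
  rw [Finset.sum_eq_single a (by simp +contextual) (by simp),
    Finset.sum_eq_single a (by simp +contextual) (by simp)] at e'
  simpa using e'

end Example

/-! ### The numerical data and the conclusion. -/

/-- Raise the quadratic function `w` to the power `m`: `W y m = w(y)^m` is a character of `ℤ/p²`
because `w(y)` is a `p²`-th root of unity, and the cross term becomes `χ(a b)^m = χ(r(m) a b)` with
`r` reduction mod `p`. -/
lemma exists_quadratic_characters (k : Type u) [Field k] [IsAlgClosed k] [CharZero k] (p : ℕ)
    [Fact p.Prime] :
    ∃ (χ : AddChar (ZMod p) k) (r : Multiplicative (ZMod (p ^ 2)) →* Multiplicative (ZMod p))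
      (W : ZMod p → Multiplicative (ZMod (p ^ 2)) →* k), χ.IsPrimitive ∧
      (∀ a b m, W (a + b) m = W a m * W b m * χ ((r m).toAdd * (a * b))) ∧
      ∃ a b m, W (a + b) m ≠ W a m * W b m := by
  obtain ⟨χ, w, hχ, hw1, hw⟩ := exists_quadratic_refinement (k := k) p
  have : NeZero (p ^ 2) := ⟨pow_ne_zero _ (Fact.out : p.Prime).ne_zero⟩
  let r : Multiplicative (ZMod (p ^ 2)) →* Multiplicative (ZMod p) :=
    AddMonoidHom.toMultiplicative
      (ZMod.castHom (dvd_pow_self p two_ne_zero) (ZMod p)).toAddMonoidHom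
  let W : ZMod p → Multiplicative (ZMod (p ^ 2)) →* k :=
    fun y => (AddChar.zmodChar (p ^ 2) (hw1 y)).toMonoidHom
  have hWr : ∀ a b m, W (a + b) m = W a m * W b m * χ ((r m).toAdd * (a * b)) := by
    intro a b m
    change w (a + b) ^ m.toAdd.val = w a ^ m.toAdd.val * w b ^ m.toAdd.val *
      χ (ZMod.castHom (dvd_pow_self p two_ne_zero) (ZMod p) m.toAdd * (a * b))
    have h : ZMod.castHom (dvd_pow_self p two_ne_zero) (ZMod p) m.toAdd =
        ((m.toAdd.val : ℕ) : ZMod p) := by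
      rw [← map_natCast (ZMod.castHom (dvd_pow_self p two_ne_zero) (ZMod p)),
        ZMod.natCast_zmod_val]
    rw [h, hw, mul_pow, mul_pow, ← AddChar.map_nsmul_eq_pow, nsmul_eq_mul]
  -- At `a = b = m = 1` the cross term is `χ(1)`, which differs from `1` because `χ` is primitive.
  have hne : W (1 + 1) (.ofAdd 1) ≠ W 1 (.ofAdd 1) * W 1 (.ofAdd 1) := by
    have h1 : (r (.ofAdd 1)).toAdd = 1 := map_one (ZMod.castHom (dvd_pow_self p two_ne_zero) (ZMod p))
    rw [hWr, h1, one_mul, one_mul]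
    intro h
    have h2 := (mul_eq_left₀ (mul_ne_zero ((Group.isUnit _).map (W 1)).ne_zero
      ((Group.isUnit _).map (W 1)).ne_zero)).1 h
    exact one_ne_zero ((hχ.zmod_char_eq_one_iff p 1).1 h2)
  exact ⟨χ, r, W, hχ, hWr, 1, 1, .ofAdd 1, hne⟩

end

theorem mainTheorem6 {k : Type*} [Field k] [IsAlgClosed k] [CharZero k] (p : ℕ) (hp : p.Prime) :
    ∃ (G : Type) (_ : CommGroup G) (_ : Finite G)
      (D : YDHopf k (MonoidAlgebra k (Multiplicative (ZMod p))) (MonoidAlgebra k G)),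
      (Function.Injective D.phiYD ∧ ¬ Function.Surjective D.phiYD) ∧
      (∃ F ∈ D.autHopfProj,
        ¬ ((∀ b, Coalgebra.counit (R := k) (D.left F b) = Coalgebra.counit (R := k) b) ∧
          ∀ b, Coalgebra.comul (R := k) (D.left F b) =
            TensorProduct.map (D.left F) (D.left F) (Coalgebra.comul b))) ∧
      (Function.Injective D.phiNu ∧
        ¬ Set.range D.phiNu ⊆
          {σ | ∃ F ∈ D.autHopfProj, σ = F.toEquiv}) := by
  have : Fact p.Prime := ⟨hp⟩
  have : NeZero (p ^ 2) := ⟨pow_ne_zero _ hp.ne_zero⟩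
  obtain ⟨χ, r, W, hχ, hW, a, b, m, hne⟩ := exists_quadratic_characters k p
  have hF := diagAut_mem hχ hW
  have hc := comul_left_diagAut_ne hχ r hne
  exact ⟨Multiplicative (ZMod (p ^ 2)) × Multiplicative (ZMod p), Prod.instCommGroup,
    inferInstance, homogYD hχ r, ⟨YDHopf.phiYD_injective _, YDHopf.phiYD_not_surjective _ hF hc⟩,
    ⟨_, hF, fun h => hc (h.2 _)⟩,
    YDHopf.phiNu_injective _, YDHopf.range_phiNu_not_subset _ hF hc⟩
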